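/- There is an absolute constant $C$, and for every prime power $q$ there are constants $d_0=d_0(q)$ and $C_q$ depending only on $q$, such that the following holds. Let $p$ be the characteristic of $\mathbb F_q$. For $d\ge 1$ let $S_d^{\rm ns}$ be the set of homogeneous polynomials $F\in\mathbb F_q[X,Y,Z]$ of degree $d$ that define a smooth plane curve $C_F: F=0$, i.e. such that $F$ and its three first partial derivatives have no common zero in $\mathbb P^2(\overline{\mathbb F}_q)$, and let $C_F(\mathbb F_q)\subseteq\mathbb P^2(\mathbb F_q)$ be the set of rational points of $C_F$. Let $X_1,\dots,X_{q^2+q+1}$ be i.i.d. random variables taking the value $1$ with probability $(q+1)/(q^2+q+1)$ and the value $0$ with probability $q^2/(q^2+q+1)$. Then for all integers $d\ge 1$ and $t\ge 0$ the set $S_d^{\rm ns}$ is non-empty, and there is a real number $\delta$ with $$\frac{\#\{F\in S_d^{\rm ns} : \#C_F(\mathbb F_q)=t\}}{\#S_d^{\rm ns}}=\mathrm{Prob}\left(X_1+\dots+X_{q^2+q+1}=t\right)\,(1+\delta)$$ and $$|\delta|\le C_q\,E,\qquad\text{and moreover}\quad |\delta|\le C\,E\ \text{ if } d\ge d_0(q),$$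 where $$E=q^{t}\left(d^{-1/3}+(d-1)^2q^{-\min\left(\lfloor d/p\rfloor+1,\;d/3\right)}+d\,q^{-\lfloor (d-1)/p\rfloor-1}\right).$$ -/

import Mathlib

open MvPolynomial MeasureTheory ProbabilityTheory LinearAlgebra.Projectivization

universe u v

noncomputable section

/-- A homogeneous ternary form `F` over `K` defines a smooth plane curve: at no point of the
projective plane over an algebraic closure of `K` do `F` and its three partial derivatives vanish
simultaneously. In particular `F ≠ 0`. -/
def DefinesSmoothPlaneCurve {K : Type u} [Field K] (F : MvPolynomial (Fin 3) K) : Prop :=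
  ∀ x : Fin 3 → AlgebraicClosure K, x ≠ 0 →
    ¬ (aeval x F = 0 ∧ ∀ i : Fin 3, aeval x (pderiv i F) = 0)

/-- The set `S_d^ns` of homogeneous polynomials of degree `d` in three variables over `K` that
define a smooth plane curve. -/
def smoothForms (K : Type u) [Field K] (d : ℕ) : Set (MvPolynomial (Fin 3) K) :=
  {F | F.IsHomogeneous d ∧ DefinesSmoothPlaneCurve F}

/-- The set `C_F(K)` of `K`-rational points of the plane curve `F = 0`. -/
def rationalPoints {K : Type u} [Field K] (F : MvPolynomial (Fin 3) K) :
    Set (ℙ K (Fin 3 → K)) :=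
  {P | eval P.rep F = 0}

/-- For a homogeneous `F`, membership in `rationalPoints F` does not depend on the choice of
homogeneous coordinates. -/
theorem mk_mem_rationalPoints_iff {K : Type u} [Field K] {d : ℕ} {F : MvPolynomial (Fin 3) K}
    (hF : F.IsHomogeneous d) (v : Fin 3 → K) (hv : v ≠ 0) :
    Projectivization.mk K v hv ∈ rationalPoints F ↔ eval v F = 0 := by
  obtain ⟨a, ha⟩ := Projectivization.exists_smul_eq_mk_rep K v hv
  have h : eval ((a : K) • v) F = (a : K) ^ d * eval v F := by
    rw [eval_eq', eval_eq', Finset.mul_sum]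
    refine Finset.sum_congr rfl fun m hm => ?_
    have hm' : ∑ i, m i = d := by
      rw [hF.degree_eq_sum_deg_support hm, ← Finsupp.degree_apply, Finsupp.degree_eq_sum]
    simp only [Pi.smul_apply, smul_eq_mul, mul_pow, Finset.prod_mul_distrib,
      Finset.prod_pow_eq_pow_sum, hm']
    ring
  have h' : (a : K) • v = (Projectivization.mk K v hv).rep := ha
  simp only [rationalPoints, Set.mem_ofPred_eq, ← h', h]
  simp

/-- There are only finitely many forms of degree `d` over a finite field. -/
theorem smoothForms_finite (K : Type u) [Field K] [Finite K] (d : ℕ) :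
    (smoothForms K d).Finite := by
  have : Module.Finite K (homogeneousSubmodule (Fin 3) K d) :=
    Module.Finite.iff_fg.mpr (homogeneousSubmodule_fg (Fin 3) K d)
  have : Finite (homogeneousSubmodule (Fin 3) K d) := Module.finite_of_finite K
  exact (Set.toFinite (homogeneousSubmodule (Fin 3) K d : Set (MvPolynomial (Fin 3) K))).subset
    fun F hF => hF.1

/-- The proportion of forms `F ∈ S_d^ns` whose curve has exactly `t` rational points. -/
def smoothProportion (K : Type u) [Field K] (d t : ℕ) : ℝ :=
  ({F ∈ smoothForms K d | (rationalPoints F).ncard = t}.ncard : ℝ) / ((smoothForms K d).ncard : ℝ)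

/-- The expression inside the `O`. -/
def errorTerm (q p d t : ℕ) : ℝ :=
  (q : ℝ) ^ t *
    ((d : ℝ) ^ (-(1 / 3 : ℝ))
      + ((d : ℝ) - 1) ^ 2 * (q : ℝ) ^ (-min ((⌊(d : ℝ) / p⌋ : ℝ) + 1) ((d : ℝ) / 3))
      + (d : ℝ) * (q : ℝ) ^ (-(⌊((d : ℝ) - 1) / p⌋ : ℝ) - 1))

end

/-! ### Singularity, evaluation and degree of a point -/

noncomputable section

/-! This is Poonen's sieve with an exact equidistribution step. Record, at each of the `q ^ 2 + q +
1` rational points, the value of a form and two of its partials; by Euler's identity this jet in `K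
^ 3` is zero exactly when the curve is singular there. Of the `q ^ 3 - 1` nonzero jets, `q ^ 2 - 1`
have value zero, a fraction `(q + 1) / (q ^ 2 + q + 1)`. If jets were independent and uniform, the
point count of a smooth curve would be exactly the binomial variable (`ncard_jets_ratio`).

Let `U` be the forms nonsingular at all nonrational points of degree at most `r`. When `8 q ^ r + 3
≤ d`, any family of jets at the rational points is realised by a form vanishing to second order at
all those nonrational points (`exists_form_with_jet`, `exists_translation`). Translation by it
preserves `U`, so on `U` the jets are exactly uniform (`ncard_mul_card_of_translation_invariant`).
The density of `U` cancels in the proportion; it need only be bounded below.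

What remains is the density of forms singular at a point of degree above `r`
(`ncard_singularForms_le`). Up to degree `(d - 1) / p + 1`, singularity at one point of degree `e`
costs `q ^ (-3 e)`, and summing over points gives `O(q ^ (-r))`. Beyond that, adding independent
`p`-th powers moves the value and two partials separately: generically the two partials meet in
boundedly many points, and the value then rarely vanishes at one of them
(`ncard_perturb_singularAt_mul_le`).

Choosing `q ^ r` of order `d`, up to a factor depending on `q`, makes the absolute error `O_q(1 /
d)`. For fixed `q` the binomial probabilities with `t ≤ q ^ 2 + q + 1` are bounded below, so the
relative error is also `O_q(1 / d)`. It falls below `d ^ (-1/3)`, hence below the stated error, once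
`d` is large in terms of `q`; smaller `d` are absorbed in `C_q`. -/

/-- `F` and all its partial derivatives vanish at `v`. -/
def SingularAt {K : Type u} {L : Type v} [Field K] [Field L] [Algebra K L]
    (F : MvPolynomial (Fin 3) K) (v : Fin 3 → L) : Prop :=
  aeval v F = 0 ∧ ∀ i, aeval v (pderiv i F) = 0

/-- Ternary forms of degree `d`. -/
abbrev Forms (K : Type u) [Field K] (d : ℕ) : Submodule K (MvPolynomial (Fin 3) K) :=
  homogeneousSubmodule (Fin 3) K d

/-- Evaluation of forms at a vector. -/
def evalForm {K : Type u} {L : Type v} [Field K] [Field L] [Algebra K L]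
    (d : ℕ) (v : Fin 3 → L) : Forms K d →ₗ[K] L :=
  (aeval v : MvPolynomial (Fin 3) K →ₐ[K] L).toLinearMap.comp (Forms K d).subtype

/-- The degree over `K` of the algebra generated by the coordinates of `v`. -/
def coordDegree (K : Type u) {L : Type v} [Field K] [Field L] [Algebra K L] (v : Fin 3 → L) : ℕ :=
  Module.finrank K (Algebra.adjoin K (Set.range v))

end

/-! ### Values of forms at a point -/

section Eval

variable {K : Type u} {L : Type v} [Field K] [Field L] [Algebra K L]

@[simp] theorem evalForm_apply (d : ℕ) (v : Fin 3 → L) (F : Forms K d) :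
    evalForm d v F = aeval v (F : MvPolynomial (Fin 3) K) := rfl

instance finite_forms [Finite K] (d : ℕ) : Finite (Forms K d) := by
  have : Module.Finite K (homogeneousSubmodule (Fin 3) K d) :=
    Module.Finite.iff_fg.mpr (homogeneousSubmodule_fg (Fin 3) K d)
  exact Module.finite_of_finite K

theorem moduleFinite_forms (d : ℕ) : Module.Finite K (Forms K d) :=
  Module.Finite.iff_fg.mpr (homogeneousSubmodule_fg (Fin 3) K d)

theorem range_evalForm_le_adjoin (m : ℕ) (v : Fin 3 → L) :
    LinearMap.range (evalForm (K := K) m v) ≤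
      Subalgebra.toSubmodule (Algebra.adjoin K (Set.range v)) := by
  rintro _ ⟨F, rfl⟩
  rw [Algebra.adjoin_range_eq_range_aeval]
  exact ⟨_, rfl⟩

theorem mul_mem_range_evalForm (m : ℕ) (v : Fin 3 → L) (l : Fin 3) {x : L}
    (hx : x ∈ LinearMap.range (evalForm (K := K) m v)) :
    v l * x ∈ LinearMap.range (evalForm (K := K) (m + 1) v) := by
  obtain ⟨F, rfl⟩ := hx
  refine ⟨⟨X l * (F : MvPolynomial (Fin 3) K), ?_⟩, by simp⟩
  rw [add_comm]
  exact (isHomogeneous_X K l).mul F.2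

/-- The space of values at `v` of forms of degree `m` has dimension at least `m + 1`, unless it is
already everything. -/
theorem finrank_range_evalForm (v : Fin 3 → L) {i : Fin 3} (hi : v i = 1) (m : ℕ) :
    m + 1 ≤ Module.finrank K (LinearMap.range (evalForm (K := K) m v)) ∨
      LinearMap.range (evalForm (K := K) m v) =
        Subalgebra.toSubmodule (Algebra.adjoin K (Set.range v)) := by
  have hone : ∀ m, (1 : L) ∈ LinearMap.range (evalForm (K := K) m v) := fun m =>
    ⟨⟨X i ^ m, by simpa using (isHomogeneous_X K i).pow m⟩, by simp [hi]⟩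
  have hle : ∀ m, LinearMap.range (evalForm (K := K) m v) ≤
      LinearMap.range (evalForm (K := K) (m + 1) v) := fun m x hx => by
    simpa [hi] using mul_mem_range_evalForm m v i hx
  have hfin : ∀ m, Module.Finite K (LinearMap.range (evalForm (K := K) m v)) := fun m =>
    have := moduleFinite_forms (K := K) m
    inferInstance
  induction m with
  | zero =>
    left
    have := hfin 0
    rw [zero_add, Nat.one_le_iff_ne_zero, Ne, Submodule.finrank_eq_zero]
    intro h
    have := hone 0
    rw [h] at this
    simp at this
  | succ m ih =>
    rcases ih with ih | ih
    · by_cases h : LinearMap.range (evalForm (K := K) m v) =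
        LinearMap.range (evalForm (K := K) (m + 1) v)
      · right
        rw [← h]
        refine le_antisymm (range_evalForm_le_adjoin m v) fun a ha => ?_
        -- Once two consecutive value spaces agree, the space is stable under multiplication by
        -- every coordinate; as it contains `1`, it is the whole algebra.
        suffices ∀ x ∈ LinearMap.range (evalForm (K := K) m v),
            a * x ∈ LinearMap.range (evalForm (K := K) m v) by
          simpa using this 1 (hone m)
        have ha' : a ∈ Algebra.adjoin K (Set.range v) := ha
        induction ha' using Algebra.adjoin_induction with
        | mem x hx =>
          obtain ⟨l, rfl⟩ := hx
          intro x hx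
          rw [h]
          exact mul_mem_range_evalForm m v l hx
        | algebraMap r =>
          intro x hx
          rw [← Algebra.smul_def]
          exact Submodule.smul_mem _ _ hx
        | add x y hx hy h1 h2 =>
          intro z hz
          rw [add_mul]
          exact Submodule.add_mem _ (h1 hx _ hz) (h2 hy _ hz)
        | mul x y hx hy h1 h2 =>
          intro z hz
          rw [mul_assoc]
          exact h1 hx _ (h2 hy _ hz)
      · left
        have := hfin (m + 1)
        have := Submodule.finrank_lt_finrank_of_lt (lt_of_le_of_ne (hle m) h)
        omega
    · right
      exact le_antisymm (range_evalForm_le_adjoin (m + 1) v) (ih ▸ hle m)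

/-- The two alternatives serve generic points and closed points of large degree. An infinite algebra
cannot equal the finite space of values, which leaves the dimension bound `m + 1`. -/
theorem pow_le_card_range_evalForm [Finite K] {v : Fin 3 → L} {i : Fin 3} (hi : v i = 1) {m n : ℕ}
    (hn : n ≤ m + 1)
    (h : Infinite (Algebra.adjoin K (Set.range v)) ∨ n ≤ coordDegree K v) :
    Nat.card K ^ n ≤ Nat.card (LinearMap.range (evalForm (K := K) m v)) := by
  have := moduleFinite_forms (K := K) m
  rw [Module.natCard_eq_pow_finrank (K := K) (V := LinearMap.range (evalForm (K := K) m v))]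
  refine Nat.pow_le_pow_right (Nat.card_pos (α := K)) ?_
  rcases finrank_range_evalForm (K := K) v hi m with h1 | h1
  · omega
  · rcases h with h | h
    · exfalso
      have h2 : Finite (LinearMap.range (evalForm (K := K) m v)) :=
        Module.finite_of_finite K
      rw [h1] at h2
      exact not_finite_iff_infinite.mpr h h2
    · rw [h1]; exact h

theorem finite_adjoin [Finite K] [Algebra.IsAlgebraic K L] (v : Fin 3 → L) :
    Module.Finite K (Algebra.adjoin K (Set.range v)) :=
  Module.Finite.iff_fg.mpr <| fg_adjoin_of_finite (Set.finite_range v)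
    fun x _ => (Algebra.IsAlgebraic.isAlgebraic x).isIntegral

theorem range_evalForm_eq [Finite K] [Algebra.IsAlgebraic K L] {v : Fin 3 → L} {i : Fin 3}
    (hi : v i = 1) {m : ℕ} (h : coordDegree K v ≤ m + 1) :
    LinearMap.range (evalForm (K := K) m v) =
        Subalgebra.toSubmodule (Algebra.adjoin K (Set.range v)) := by
  rcases finrank_range_evalForm (K := K) v hi m with h1 | h1
  · have : Module.Finite K (Subalgebra.toSubmodule (Algebra.adjoin K (Set.range v))) :=
      finite_adjoin v
    exact Submodule.eq_of_le_of_finrank_le (range_evalForm_le_adjoin m v) (h.trans h1)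
  · exact h1

theorem card_adjoin [Finite K] [Algebra.IsAlgebraic K L] (v : Fin 3 → L) :
    Nat.card (Algebra.adjoin K (Set.range v)) = Nat.card K ^ coordDegree K v :=
  have := finite_adjoin (K := K) v
  Module.natCard_eq_pow_finrank

/-- The coordinates generate a finite domain, hence the field with `q ^ e` elements for `e` the
degree, and the `q ^ e`-power map fixes it. -/
theorem pow_card_coordDegree [Finite K] [Algebra.IsAlgebraic K L] (v : Fin 3 → L) (l : Fin 3) :
    v l ^ Nat.card K ^ coordDegree K v = v l := by
  have := finite_adjoin (K := K) v
  have : Finite (Algebra.adjoin K (Set.range v)) := Module.finite_of_finite K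
  have := Fintype.ofFinite (Algebra.adjoin K (Set.range v))
  classical
  let _ := Fintype.fieldOfDomain (Algebra.adjoin K (Set.range v))
  have h := FiniteField.pow_card (⟨v l, Algebra.subset_adjoin ⟨l, rfl⟩⟩ :
    Algebra.adjoin K (Set.range v))
  rw [← Nat.card_eq_fintype_card, card_adjoin] at h
  exact congrArg Subtype.val h

theorem coordDegree_pos [Finite K] [Algebra.IsAlgebraic K L] (v : Fin 3 → L) :
    1 ≤ coordDegree K v :=
  have := finite_adjoin (K := K) v
  Module.finrank_pos

theorem exists_algebraMap_of_coordDegree_eq_one {v : Fin 3 → L} (h : coordDegree K v = 1) :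
    ∃ w : Fin 3 → K, v = fun l => algebraMap K L (w l) := by
  have h1 : Algebra.adjoin K (Set.range v) = ⊥ := Subalgebra.finrank_eq_one_iff.mp h
  have h2 : ∀ l, ∃ w, algebraMap K L w = v l := fun l => by
    have : v l ∈ Algebra.adjoin K (Set.range v) := Algebra.subset_adjoin ⟨l, rfl⟩
    rw [h1] at this
    exact Algebra.mem_bot.mp this
  choose w hw using h2
  exact ⟨w, funext fun l => (hw l).symm⟩

end Eval

/-! ### Counting in finite groups and products -/

section Counting

/-- Fibres of a linear map composed with the `p`-th power are small when the image is large. -/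
theorem ncard_add_pow_eq_zero_mul_le {K : Type*} {G L : Type*} [Field K] [AddCommGroup G]
    [Module K G] [Finite G] [Field L] [Algebra K L] (p : ℕ) [Fact p.Prime] [CharP L p]
    (φ : G →ₗ[K] L) {Q : ℕ} (hQ : Q ≤ Nat.card (LinearMap.range φ)) (c : L) :
    {y : G | c + φ y ^ p = 0}.ncard * Q ≤ Nat.card G := by
  rcases Set.eq_empty_or_nonempty {y : G | c + φ y ^ p = 0} with h | ⟨y₀, hy₀⟩
  · simp [h]
  -- Additivity of Frobenius places the solutions in a single coset of the kernel.
  have h1 : {y : G | c + φ y ^ p = 0} ⊆ (fun z => z + y₀) '' (LinearMap.ker φ : Set G) := by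
    intro y hy
    refine ⟨y - y₀, ?_, by simp⟩
    have hy₀' : c + φ y₀ ^ p = 0 := hy₀
    have hy' : c + φ y ^ p = 0 := hy
    have : (φ y - φ y₀) ^ p = 0 := by
      rw [sub_pow_char]; linear_combination hy' - hy₀'
    have := pow_eq_zero_iff (Fact.out : p.Prime).ne_zero |>.mp this
    simpa [sub_eq_zero] using this
  have h2 : {y : G | c + φ y ^ p = 0}.ncard ≤ Nat.card (LinearMap.ker φ) :=
    (Set.ncard_le_ncard h1 (Set.toFinite _)).trans
      ((Set.ncard_image_le (Set.toFinite _)).trans (le_of_eq rfl))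
  have h3 : Nat.card (LinearMap.ker φ) * Nat.card (LinearMap.range φ) = Nat.card G := by
    rw [Submodule.card_eq_card_quotient_mul_card (LinearMap.ker φ),
      Nat.card_congr φ.quotKerEquivRange.toEquiv, mul_comm]
  calc _ ≤ Nat.card (LinearMap.ker φ) * Nat.card (LinearMap.range φ) := Nat.mul_le_mul h2 hQ
    _ = _ := h3

/-- A finite additive group has as many elements as the kernel times the image. -/
theorem ncard_ker_mul_le {G B : Type*} [AddCommGroup G] [Finite G] [AddCommGroup B]
    (φ : G →+ B) {Q : ℕ} (hQ : Q ≤ Nat.card φ.range) {A : Set G} (hA : ∀ x ∈ A, φ x = 0) :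
    A.ncard * Q ≤ Nat.card G := by
  have h3 : Nat.card φ.ker * Nat.card φ.range = Nat.card G := by
    rw [AddSubgroup.card_eq_card_quotient_mul_card_addSubgroup φ.ker,
      Nat.card_congr (QuotientAddGroup.quotientKerEquivRange φ).toEquiv, mul_comm]
  have h2 : A.ncard ≤ Nat.card φ.ker := Set.ncard_le_ncard (t := (φ.ker : Set G)) hA (Set.toFinite _)
  calc _ ≤ Nat.card φ.ker * Nat.card φ.range := Nat.mul_le_mul h2 hQ
    _ = _ := h3

theorem ncard_iUnion_finset_mul_le {α ι : Type*} [Finite α] (s : Finset ι) (A : ι → Set α)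
    {Q N : ℕ} (h : ∀ i ∈ s, (A i).ncard * Q ≤ N) :
    {x | ∃ i ∈ s, x ∈ A i}.ncard * Q ≤ s.card * N := by
  classical
  induction s using Finset.induction_on with
  | empty => simp
  | insert a s ha ih =>
    have h1 : {x | ∃ i ∈ insert a s, x ∈ A i} = A a ∪ {x | ∃ i ∈ s, x ∈ A i} := by
      ext x; simp
    rw [h1, Finset.card_insert_of_notMem ha]
    calc _ ≤ ((A a).ncard + {x | ∃ i ∈ s, x ∈ A i}.ncard) * Q :=
          Nat.mul_le_mul_right _ (Set.ncard_union_le _ _)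
      _ ≤ N + s.card * N := by
          rw [add_mul]
          exact add_le_add (h a (by simp)) (ih fun i hi => h i (by simp [hi]))
      _ = _ := by ring

/-- Counting a subset of a product by its slices. -/
theorem ncard_mul_le_of_slices {α β γ : Type*} [Finite α] [Finite β] [Finite γ] (e : γ ≃ α × β)
    (A : Set γ) {Q M : ℕ}
    (h : ∀ x, {y | e.symm (x, y) ∈ A}.ncard * Q ≤ M * Nat.card β) :
    A.ncard * Q ≤ M * Nat.card γ := by
  classical
  have := Fintype.ofFinite α
  have h0 : A.ncard = ∑ x : α, {y | e.symm (x, y) ∈ A}.ncard := by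
    have h1 : Nat.card A = Nat.card (Σ x : α, {y | e.symm (x, y) ∈ A}) :=
      Nat.card_congr
        { toFun := fun a => ⟨(e a).1, (e a).2, by simp⟩
          invFun := fun s => ⟨e.symm (s.1, s.2.1), s.2.2⟩
          left_inv := fun a => by simp
          right_inv := fun ⟨x, y, hy⟩ => Sigma.subtype_ext (by simp) (by simp) }
    rw [Nat.card_sigma] at h1
    exact h1
  rw [h0, Finset.sum_mul]
  calc _ ≤ ∑ _x : α, M * Nat.card β := Finset.sum_le_sum fun x _ => h x
    _ = _ := by
      rw [Nat.card_congr e, Nat.card_prod, Finset.sum_const, Finset.card_univ,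
        Nat.card_eq_fintype_card (α := α), smul_eq_mul]; ring

/-- Averaging over translates. -/
theorem ncard_mul_le_of_translates {G P : Type*} [AddCommGroup G] [Finite G] [Finite P] [Nonempty P]
    (T : P → G) (A : Set G) {Q M : ℕ}
    (h : ∀ x, {y | x + T y ∈ A}.ncard * Q ≤ M * Nat.card P) :
    A.ncard * Q ≤ M * Nat.card G := by
  classical
  have h1 : {z : G × P | z.1 + T z.2 ∈ A}.ncard * Q ≤ M * Nat.card (G × P) :=
    ncard_mul_le_of_slices (Equiv.refl _) _ h
  have h2 : {z : G × P | z.1 + T z.2 ∈ A}.ncard = A.ncard * Nat.card P := by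
    rw [← Set.ncard_univ P, ← Set.ncard_prod]
    -- The shear `(x, y) ↦ (x + T y, y)` turns the averaged set into `A × P`.
    refine Set.ncard_congr (fun z _ => (z.1 + T z.2, z.2)) ?_ ?_ ?_
    · rintro ⟨x, y⟩ h; exact ⟨h, trivial⟩
    · rintro ⟨x, y⟩ ⟨x', y'⟩ _ _ h
      simp only [Prod.mk.injEq] at h
      obtain ⟨h1, rfl⟩ := h
      simpa using h1
    · rintro ⟨x, y⟩ ⟨h, _⟩
      exact ⟨(x - T y, y), by simpa using h, by simp⟩
  rw [h2, Nat.card_prod] at h1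
  have hP : 0 < Nat.card P := Nat.card_pos
  refine Nat.le_of_mul_le_mul_right ?_ hP
  calc _ = A.ncard * Nat.card P * Q := by ring
    _ ≤ _ := h1
    _ = _ := by ring

end Counting

/-! ### Elimination and common zeros of two ternary forms -/

noncomputable section

/-- Dehomogenisation: `X j` becomes the inner variable, `X k` the outer one, and the remaining
variable becomes `1`. -/
def dehomogenize (K : Type u) [Field K] (j k : Fin 3) :
    MvPolynomial (Fin 3) K →ₐ[K] Polynomial (Polynomial K) :=
  aeval fun l => Polynomial.C (Polynomial.X ^ (if l = j then 1 else 0)) *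
    Polynomial.X ^ (if l = k then 1 else 0)

/-- The vector with coordinates `1`, `t`, `y` at `i`, `j`, and elsewhere. -/
def chartVec {L : Type v} [One L] (i j : Fin 3) (t y : L) : Fin 3 → L :=
  fun l => if l = i then 1 else if l = j then t else y

end

section Elimination

variable {K : Type u} [Field K]

theorem dehomogenize_eq_sum (j k : Fin 3) (F : MvPolynomial (Fin 3) K) :
    dehomogenize K j k F =
      ∑ m ∈ F.support, Polynomial.C (Polynomial.C (coeff m F) * Polynomial.X ^ m j) *
        Polynomial.X ^ m k := by
  rw [dehomogenize, aeval_def, eval₂_eq']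
  refine Finset.sum_congr rfl fun m _ => ?_
  simp only [mul_pow, Finset.prod_mul_distrib, ← Polynomial.C_pow, ← pow_mul,
    Finset.prod_pow_eq_pow_sum, ← map_prod]
  simp only [ite_mul, one_mul, zero_mul, Finset.sum_ite_eq', Finset.mem_univ, if_true, map_mul,
    mul_assoc]
  rfl

theorem natDegree_dehomogenize_le (j k : Fin 3) {N : ℕ} {F : MvPolynomial (Fin 3) K}
    (hF : F.IsHomogeneous N) : (dehomogenize K j k F).natDegree ≤ N := by
  rw [dehomogenize_eq_sum]
  refine Polynomial.natDegree_sum_le_of_forall_le _ _ fun m hm => ?_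
  refine (Polynomial.natDegree_C_mul_X_pow_le _ _).trans ?_
  have := hF.degree_eq_sum_deg_support hm
  rw [this]
  exact Finsupp.le_degree k m

theorem natDegree_coeff_dehomogenize_le (j k : Fin 3) {N : ℕ} {F : MvPolynomial (Fin 3) K}
    (hF : F.IsHomogeneous N) (n : ℕ) : ((dehomogenize K j k F).coeff n).natDegree ≤ N := by
  rw [dehomogenize_eq_sum, Polynomial.finsetSum_coeff]
  refine Polynomial.natDegree_sum_le_of_forall_le _ _ fun m hm => ?_
  rw [Polynomial.coeff_C_mul_X_pow]
  split_ifs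
  · refine (Polynomial.natDegree_C_mul_X_pow_le _ _).trans ?_
    rw [hF.degree_eq_sum_deg_support hm]
    exact Finsupp.le_degree j m
  · simp

theorem eval₂_dehomogenize {L : Type v} [Field L] [Algebra K L] {i j k : Fin 3} (hij : i ≠ j)
    (hik : i ≠ k) (hjk : j ≠ k) {v : Fin 3 → L} (hi : v i = 1) (F : MvPolynomial (Fin 3) K) :
    (dehomogenize K j k F).eval₂ (Polynomial.aeval (v j) : Polynomial K →ₐ[K] L).toRingHom (v k) =
      aeval v F := by
  induction F using MvPolynomial.induction_on with
  | C a =>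
    rw [← MvPolynomial.algebraMap_eq, AlgHom.commutes, AlgHom.commutes]
    simp [Polynomial.algebraMap_apply]
  | add p q hp hq => simp only [map_add, Polynomial.eval₂_add, hp, hq]
  | mul_X p l hp =>
    rw [map_mul, Polynomial.eval₂_mul, hp, map_mul, aeval_X]
    congr 1
    have hl : l = i ∨ l = j ∨ l = k := by omega
    rcases hl with rfl | rfl | rfl
    · simp [dehomogenize, hij, hik, hi]
    · simp [dehomogenize, hjk]
    · simp [dehomogenize, hjk.symm]

/-- Elimination of the outer variable from two bivariate polynomials without common root over the
generic fibre. -/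
theorem exists_eliminant {Ω : Type v} [Field Ω] [Algebra K Ω] [IsAlgClosed Ω] {t : Ω}
    (ht : Transcendental K t) {N : ℕ} {f g : Polynomial (Polynomial K)} (hf0 : f ≠ 0)
    (hf : f.natDegree ≤ N) (hg : g.natDegree ≤ N) (hf' : ∀ n, (f.coeff n).natDegree ≤ N)
    (hg' : ∀ n, (g.coeff n).natDegree ≤ N)
    (h : ∀ y : Ω, ¬ (f.eval₂ (Polynomial.aeval t : Polynomial K →ₐ[K] Ω).toRingHom y = 0 ∧
      g.eval₂ (Polynomial.aeval t : Polynomial K →ₐ[K] Ω).toRingHom y = 0)) :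
    ∃ R : Polynomial K, R ≠ 0 ∧ R.natDegree ≤ (2 * N + 1) * N ∧
      ∀ (L : Type u) [Field L] [Algebra K L] (x y : L),
        f.eval₂ (Polynomial.aeval x : Polynomial K →ₐ[K] L).toRingHom y = 0 →
        g.eval₂ (Polynomial.aeval x : Polynomial K →ₐ[K] L).toRingHom y = 0 →
        Polynomial.aeval x R = 0 := by
  set ι := (Polynomial.aeval t : Polynomial K →ₐ[K] Ω).toRingHom with hι
  have hinj : Function.Injective ι := transcendental_iff_injective.mp ht
  -- Raising the formal degree of `g` by one keeps the Sylvester matrix nonempty, so that the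
  -- resultant lies in the ideal `(f, g)` even when both degrees are `0`. The cost is a factor equal
  -- up to sign to the leading coefficient of `f`, which is nonzero.
  refine ⟨Polynomial.resultant f g f.natDegree (g.natDegree + 1), ?_, ?_, ?_⟩
  · rw [Polynomial.resultant_add_right_deg _ _ _ _ _ le_rfl]
    refine mul_ne_zero (by simpa using hf0) ?_
    intro h0
    have h1 : Polynomial.resultant (f.map ι) (g.map ι) = 0 := by
      rw [Polynomial.natDegree_map_eq_of_injective hinj,
        Polynomial.natDegree_map_eq_of_injective hinj, Polynomial.resultant_map_map, h0, map_zero]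
    rw [Polynomial.resultant_eq_zero_iff] at h1
    refine h1.2 ?_
    rw [Polynomial.isCoprime_iff_aeval_ne_zero_of_isAlgClosed Ω Ω]
    intro y
    by_contra! hy
    simp only [Polynomial.coe_aeval_eq_eval, Polynomial.eval_map] at hy
    exact h y hy
  -- The matrix has size at most `2 N + 1` and entries of degree at most `N`.
  · rw [Polynomial.resultant, Matrix.det_apply]
    refine Polynomial.natDegree_sum_le_of_forall_le _ _ fun σ _ => ?_
    refine (Polynomial.natDegree_smul_le _ _).trans ?_
    refine (Polynomial.natDegree_prod_le _ _).trans ?_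
    refine (Finset.sum_le_card_nsmul _ _ N fun l _ => ?_).trans ?_
    · rw [Polynomial.sylvester, Matrix.of_apply]
      refine Fin.addCases (fun l => ?_) (fun l => ?_) l
      · rw [Fin.addCases_left]; split_ifs
        · exact hg' _
        · simp
      · rw [Fin.addCases_right]; split_ifs
        · exact hf' _
        · simp
    · simp only [Finset.card_univ, Fintype.card_fin, smul_eq_mul]
      exact Nat.mul_le_mul_right _ (by omega)
  · intro L _ _ x y hx hy
    obtain ⟨p, q, -, -, hpq⟩ := Polynomial.exists_mul_add_mul_eq_C_resultant
      (m := f.natDegree) (n := g.natDegree + 1) f g le_rfl (by omega) (by omega)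
    have := congrArg (Polynomial.eval₂ (Polynomial.aeval x : Polynomial K →ₐ[K] L).toRingHom y) hpq
    rw [Polynomial.eval₂_add, Polynomial.eval₂_mul, Polynomial.eval₂_mul, hx, hy, zero_mul,
      zero_mul, zero_add, Polynomial.eval₂_C] at this
    exact this.symm

theorem chartVec_eq {L : Type v} [One L] {i j k : Fin 3} (hij : i ≠ j)
    (hik : i ≠ k) (hjk : j ≠ k) (t y : L) :
    chartVec i j t y i = 1 ∧ chartVec i j t y j = t ∧ chartVec i j t y k = y := by
  simp [chartVec, hij.symm, hik.symm, hjk.symm]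

theorem exists_finset_common_zeros {Ω : Type v} [Field Ω] [Algebra K Ω] [IsAlgClosed Ω] {t : Ω}
    (ht : Transcendental K t) {i j k : Fin 3} (hij : i ≠ j) (hik : i ≠ k) (hjk : j ≠ k)
    {N : ℕ} {a b : MvPolynomial (Fin 3) K} (ha : a.IsHomogeneous N) (hb : b.IsHomogeneous N)
    {w : Fin 3 → Ω} (hw : w i = 1) (haw : aeval w a ≠ 0)
    (h1 : ∀ y, ¬ (aeval (chartVec i j t y) a = 0 ∧ aeval (chartVec i j t y) b = 0))
    (h2 : ∀ y, ¬ (aeval (chartVec i k t y) a = 0 ∧ aeval (chartVec i k t y) b = 0))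
    (L : Type u) [Field L] [Algebra K L] :
    ∃ s : Finset (Fin 3 → L), s.card ≤ ((2 * N + 1) * N) ^ 2 ∧
      ∀ v : Fin 3 → L, v i = 1 → aeval v a = 0 → aeval v b = 0 → v ∈ s := by
  classical
  have key : ∀ j k : Fin 3, i ≠ j → i ≠ k → j ≠ k →
      (∀ y, ¬ (aeval (chartVec i j t y) a = 0 ∧ aeval (chartVec i j t y) b = 0)) →
      ∃ s : Finset L, s.card ≤ (2 * N + 1) * N ∧
      ∀ v : Fin 3 → L, v i = 1 → aeval v a = 0 → aeval v b = 0 → v j ∈ s := by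
    intro j k hij hik hjk h
    have h0 : dehomogenize K j k a ≠ 0 := by
      intro h0
      rw [← eval₂_dehomogenize hij hik hjk hw, h0, Polynomial.eval₂_zero] at haw
      exact haw rfl
    obtain ⟨R, hR0, hRd, hR⟩ := exists_eliminant ht h0 (natDegree_dehomogenize_le j k ha)
      (natDegree_dehomogenize_le j k hb) (natDegree_coeff_dehomogenize_le j k ha)
      (natDegree_coeff_dehomogenize_le j k hb) (fun y => by
        obtain ⟨e1, e2, e3⟩ := chartVec_eq hij hik hjk t y
        have := h y
        rwa [← eval₂_dehomogenize hij hik hjk e1, ← eval₂_dehomogenize hij hik hjk e1, e2, e3]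
          at this)
    refine ⟨(R.map (algebraMap K L)).roots.toFinset, ?_, fun v hv hva hvb => ?_⟩
    · exact (Multiset.toFinset_card_le _).trans ((Polynomial.card_roots' _).trans
        (Polynomial.natDegree_map_le.trans hRd))
    · rw [Multiset.mem_toFinset, Polynomial.mem_roots', Polynomial.IsRoot, Polynomial.eval_map,
        ← Polynomial.aeval_def]
      refine ⟨(Polynomial.map_ne_zero_iff (algebraMap K L).injective).mpr hR0, ?_⟩
      refine hR L (v j) (v k) ?_ ?_ <;> rw [eval₂_dehomogenize hij hik hjk hv] <;> assumption
  obtain ⟨s, hs, hs'⟩ := key j k hij hik hjk h1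
  obtain ⟨s', hs2, hs2'⟩ := key k j hik hij hjk.symm h2
  refine ⟨(s ×ˢ s').image (fun z l => if l = i then 1 else if l = j then z.1 else z.2), ?_, ?_⟩
  · refine Finset.card_image_le.trans ?_
    rw [Finset.card_product, sq]
    exact Nat.mul_le_mul hs hs2
  · intro v hv hva hvb
    refine Finset.mem_image.mpr ⟨(v j, v k),
      Finset.mk_mem_product (hs' v hv hva hvb) (hs2' v hv hva hvb), funext fun l => ?_⟩
    have hl : l = i ∨ l = j ∨ l = k := by omega
    rcases hl with rfl | rfl | rfl
    · simp [hv]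
    · simp [hij.symm]
    · simp [hik.symm, hjk.symm]

/-- The form `a` has at most `N` zeros on the generic line of a chart. -/
theorem exists_finset_generic_roots {Ω : Type v} [Field Ω] [Algebra K Ω] {t : Ω}
    (ht : Transcendental K t) {i j k : Fin 3} (hij : i ≠ j) (hik : i ≠ k) (hjk : j ≠ k)
    {N : ℕ} {a : MvPolynomial (Fin 3) K} (ha : a.IsHomogeneous N)
    {w : Fin 3 → Ω} (hw : w i = 1) (haw : aeval w a ≠ 0) :
    ∃ s : Finset Ω, s.card ≤ N ∧ ∀ y, aeval (chartVec i j t y) a = 0 → y ∈ s := by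
  classical
  set ι := (Polynomial.aeval t : Polynomial K →ₐ[K] Ω).toRingHom with hι
  have hinj : Function.Injective ι := transcendental_iff_injective.mp ht
  have h0 : dehomogenize K j k a ≠ 0 := by
    intro h0
    rw [← eval₂_dehomogenize hij hik hjk hw, h0, Polynomial.eval₂_zero] at haw
    exact haw rfl
  refine ⟨((dehomogenize K j k a).map ι).roots.toFinset, ?_, fun y hy => ?_⟩
  · exact (Multiset.toFinset_card_le _).trans ((Polynomial.card_roots' _).trans
        (Polynomial.natDegree_map_le.trans (natDegree_dehomogenize_le j k ha)))
  · rw [Multiset.mem_toFinset, Polynomial.mem_roots', Polynomial.IsRoot, Polynomial.eval_map]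
    refine ⟨(Polynomial.map_ne_zero_iff hinj).mpr h0, ?_⟩
    obtain ⟨e1, e2, e3⟩ := chartVec_eq hij hik hjk t y
    rwa [← eval₂_dehomogenize hij hik hjk e1, e2, e3] at hy

end Elimination

/-! ### Perturbation by `p`-th powers -/

section Perturbation

variable {K : Type u} [Field K] (p : ℕ) [Fact p.Prime] [CharP K p]

/-- Perturbing a form by multiples of `p`-th powers changes the partial derivatives
independently of each other and of the value. -/
noncomputable def perturb (i j k : Fin 3) {d : ℕ} (hd : 1 ≤ d) :
    Forms K ((d - 1) / p) × Forms K ((d - 1) / p) × Forms K (d / p) →+ Forms K d where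
  -- The powers of `X i` only pad the degree to `d` and equal `1` on the chart `v i = 1`. The `p`-th
  -- powers have zero derivative, so each of the partials along `j` and `k` sees just one component.
  toFun g := ⟨X j * (X i ^ ((d - 1) % p) * (g.1 : MvPolynomial (Fin 3) K) ^ p) +
    X k * (X i ^ ((d - 1) % p) * (g.2.1 : MvPolynomial (Fin 3) K) ^ p) +
    X i ^ (d % p) * (g.2.2 : MvPolynomial (Fin 3) K) ^ p, by
      have h1 : d = 1 + (1 * ((d - 1) % p) + (d - 1) / p * p) := by
        have := Nat.mod_add_div (d - 1) p
        rw [mul_comm ((d - 1) / p)]; omega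
      have h2 : d = 1 * (d % p) + d / p * p := by
        rw [one_mul, mul_comm (d / p)]; exact (Nat.mod_add_div d p).symm
      have e : ∀ (l : Fin 3) (G : Forms K ((d - 1) / p)),
          (X l * (X i ^ ((d - 1) % p) * (G : MvPolynomial (Fin 3) K) ^ p)).IsHomogeneous d := by
        intro l G
        have := (isHomogeneous_X K l).mul (((isHomogeneous_X K i).pow ((d - 1) % p)).mul
          (IsHomogeneous.pow G.2 p))
        rwa [← h1] at this
      have e2 : (X i ^ (d % p) * (g.2.2 : MvPolynomial (Fin 3) K) ^ p).IsHomogeneous d := by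
        have := ((isHomogeneous_X K i).pow (d % p)).mul (IsHomogeneous.pow g.2.2.2 p)
        rwa [← h2] at this
      exact ((e j g.1).add (e k g.2.1)).add e2⟩
  map_zero' := by
    have := (Fact.out : p.Prime).ne_zero
    ext1; simp [zero_pow this]
  map_add' g h := by
    ext1
    simp only [Prod.fst_add, Prod.snd_add, Submodule.coe_add, add_pow_char]
    ring

variable {p} {i j k : Fin 3} (hij : i ≠ j) (hik : i ≠ k) (hjk : j ≠ k) {d : ℕ} (hd : 1 ≤ d)
  (g : Forms K ((d - 1) / p) × Forms K ((d - 1) / p) × Forms K (d / p))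

include hij hjk in
theorem pderiv_perturb_fst : pderiv j (perturb p i j k hd g : MvPolynomial (Fin 3) K) =
    X i ^ ((d - 1) % p) * (g.1 : MvPolynomial (Fin 3) K) ^ p := by
  simp [perturb, Derivation.leibniz, Derivation.leibniz_pow _ (X i),
    pderiv_X_of_ne hij, pderiv_X_of_ne hjk.symm]

include hik hjk in
theorem pderiv_perturb_snd : pderiv k (perturb p i j k hd g : MvPolynomial (Fin 3) K) =
    X i ^ ((d - 1) % p) * (g.2.1 : MvPolynomial (Fin 3) K) ^ p := by
  simp [perturb, Derivation.leibniz, Derivation.leibniz_pow _ (X i),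
    pderiv_X_of_ne hik, pderiv_X_of_ne hjk]

theorem aeval_perturb {L : Type v} [Field L] [Algebra K L] {v : Fin 3 → L} (hv : v i = 1) :
    aeval v (perturb p i j k hd g : MvPolynomial (Fin 3) K) =
      v j * evalForm _ v g.1 ^ p + v k * evalForm _ v g.2.1 ^ p + evalForm _ v g.2.2 ^ p := by
  simp [perturb, hv]

end Perturbation

/-! ### Forms singular at a given point, or at some point of large degree -/

section SingularPoints

variable {K : Type u} [Field K] [Finite K] {p : ℕ} [Fact p.Prime] [CharP K p]
  {i j k : Fin 3} (hij : i ≠ j) (hik : i ≠ k) (hjk : j ≠ k) {d : ℕ} (hd : 1 ≤ d)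

include hij hik hjk hd in
/-- The forms singular at a point of small degree `e` have density at most `q ^ (-3 * e)`. -/
theorem ncard_singularAt_mul_le {L : Type v} [Field L] [Algebra K L] [Algebra.IsAlgebraic K L]
    {v : Fin 3 → L} (hv : v i = 1) (hdeg : coordDegree K v ≤ (d - 1) / p + 1) :
    {F : Forms K d | SingularAt (F : MvPolynomial (Fin 3) K) v}.ncard *
      Nat.card K ^ (3 * coordDegree K v) ≤ Nat.card (Forms K d) := by
  have : CharP L p := charP_of_injective_algebraMap (algebraMap K L).injective p
  let ψ : Forms K d →+ L × L × L :=
    { toFun := fun F => (aeval v (F : MvPolynomial (Fin 3) K),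
        aeval v (pderiv j (F : MvPolynomial (Fin 3) K)),
        aeval v (pderiv k (F : MvPolynomial (Fin 3) K)))
      map_zero' := by simp
      map_add' := by intro F G; simp }
  refine ncard_ker_mul_le ψ ?_ (fun F hF => ?_)
  · have hγ := range_evalForm_eq (K := K) hv hdeg
    have hη := range_evalForm_eq (K := K) (m := d / p) hv
      (hdeg.trans (Nat.succ_le_succ (Nat.div_le_div_right (Nat.sub_le d 1))))
    have hsurj : ∀ (m : ℕ), LinearMap.range (evalForm (K := K) m v) =
        Subalgebra.toSubmodule (Algebra.adjoin K (Set.range v)) →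
        ∀ x : Algebra.adjoin K (Set.range v), ∃ G : Forms K m,
          aeval v (G : MvPolynomial (Fin 3) K) = x := by
      intro m hm x
      have : (x : L) ∈ LinearMap.range (evalForm (K := K) m v) := hm ▸ x.2
      exact this
    choose s hs using hsurj _ hγ
    choose r hr using hsurj _ hη
    let A := Algebra.adjoin K (Set.range v)
    have : Finite (Forms K d) := finite_forms d
    have : Finite ψ.range := (Set.finite_range ψ).to_subtype
    have hcard : Nat.card K ^ (3 * coordDegree K v) = Nat.card (A × A × A) := by
      rw [Nat.card_prod, Nat.card_prod, card_adjoin]; ring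
    rw [hcard]
    -- Perturbations of zero alone already produce `q ^ (3 * e)` different jets: their three
    -- components take arbitrary values in the residue field, and Frobenius is injective.
    refine Nat.card_le_card_of_injective
      (fun x : A × A × A => (⟨ψ (perturb p i j k hd (s x.1, s x.2.1, r x.2.2)), _, rfl⟩ :
        ψ.range)) ?_
    have hfrob : Function.Injective (fun x : L => x ^ p) := frobenius_inj L p
    rintro ⟨x, y, z⟩ ⟨x', y', z'⟩ h
    have h' := congrArg Subtype.val h
    simp only [ψ, AddMonoidHom.coe_mk, ZeroHom.coe_mk, aeval_perturb hd _ hv,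
      pderiv_perturb_fst hij hjk, pderiv_perturb_snd hik hjk, map_mul, map_pow, aeval_X, hv,
      one_pow, one_mul, evalForm_apply, hs, hr, Prod.mk.injEq] at h'
    obtain ⟨h1, h2, h3⟩ := h'
    rw [h2, h3] at h1
    have h1' := add_left_cancel h1
    rw [Subtype.ext (hfrob h2), Subtype.ext (hfrob h3), Subtype.ext (hfrob h1')]
  · obtain ⟨h1, h2⟩ := hF
    simp [ψ, h1, h2]

include hij hik hjk in
/-- Points of large degree: for a fixed form, most perturbations are nonsingular at all of them. -/
theorem ncard_perturb_singularAt_mul_le (L : Type u) [Field L] [Algebra K L]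
    {Ω : Type v} [Field Ω] [Algebra K Ω] [IsAlgClosed Ω] {t : Ω} (ht : Transcendental K t)
    (F : Forms K d) :
    {g | ∃ v : Fin 3 → L, v i = 1 ∧ (d - 1) / p + 1 ≤ coordDegree K v ∧
        SingularAt ((F + perturb p i j k hd g : Forms K d) : MvPolynomial (Fin 3) K) v}.ncard *
      Nat.card K ^ ((d - 1) / p + 1) ≤
      (1 + 2 * (d - 1) + ((2 * (d - 1) + 1) * (d - 1)) ^ 2) *
        Nat.card (Forms K ((d - 1) / p) × Forms K ((d - 1) / p) × Forms K (d / p)) := by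
  classical
  set P := Forms K ((d - 1) / p) × Forms K ((d - 1) / p) × Forms K (d / p) with hP
  set Q := Nat.card K ^ ((d - 1) / p + 1) with hQ
  set B := ((2 * (d - 1) + 1) * (d - 1)) ^ 2 with hB
  have : CharP Ω p := charP_of_injective_algebraMap (algebraMap K Ω).injective p
  have : CharP L p := charP_of_injective_algebraMap (algebraMap K L).injective p
  -- An algebra containing the transcendental `t` is infinite, so at points of the generic line the
  -- space of values of forms of degree `m` has dimension at least `m + 1`.
  have hinf : ∀ v : Fin 3 → Ω, t ∈ Set.range v → Infinite (Algebra.adjoin K (Set.range v)) := by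
    intro v htv
    by_contra hfin
    rw [not_infinite_iff_finite] at hfin
    have h1 : Module.Finite K (Algebra.adjoin K (Set.range v)) := Module.Finite.of_finite
    have h2 : IsIntegral K (⟨t, Algebra.subset_adjoin htv⟩ : Algebra.adjoin K (Set.range v)) :=
      Algebra.IsIntegral.isIntegral _
    exact ht (h2.map (Algebra.adjoin K (Set.range v)).val).isAlgebraic
  let a : P → MvPolynomial (Fin 3) K := fun g =>
    pderiv j ((F + perturb p i j k hd g : Forms K d) : MvPolynomial (Fin 3) K)
  let b : P → MvPolynomial (Fin 3) K := fun g =>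
    pderiv k ((F + perturb p i j k hd g : Forms K d) : MvPolynomial (Fin 3) K)
  have ha : ∀ g, a g = pderiv j (F : MvPolynomial (Fin 3) K) +
      X i ^ ((d - 1) % p) * (g.1 : MvPolynomial (Fin 3) K) ^ p := fun g => by
    simp only [a, Submodule.coe_add, map_add, pderiv_perturb_fst hij hjk]
  have hb : ∀ g, b g = pderiv k (F : MvPolynomial (Fin 3) K) +
      X i ^ ((d - 1) % p) * (g.2.1 : MvPolynomial (Fin 3) K) ^ p := fun g => by
    simp only [b, Submodule.coe_add, map_add, pderiv_perturb_snd hik hjk]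
  have hah : ∀ g, (a g).IsHomogeneous (d - 1) := fun g =>
    IsHomogeneous.pderiv (F + perturb p i j k hd g : Forms K d).2
  have hbh : ∀ g, (b g).IsHomogeneous (d - 1) := fun g =>
    IsHomogeneous.pderiv (F + perturb p i j k hd g : Forms K d).2
  let w₀ : Fin 3 → Ω := chartVec i j t 0
  have hw₀ : w₀ i = 1 := by simp [w₀, chartVec]
  -- the first derivative vanishes identically
  let B₀ : Set P := {g | aeval w₀ (a g) = 0}
  have hB₀ : B₀.ncard * Q ≤ 1 * Nat.card P := by
    refine ncard_mul_le_of_slices (Equiv.prodComm _ _) _ fun x => ?_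
    rw [one_mul]
    refine le_trans (Nat.mul_le_mul_right _ (Set.ncard_le_ncard ?_ (Set.toFinite _)))
      (ncard_add_pow_eq_zero_mul_le p (evalForm (K := K) ((d - 1) / p) w₀)
        (pow_le_card_range_evalForm hw₀ le_rfl (Or.inl (hinf _ ⟨j, by simp [w₀, chartVec, hij.symm]⟩)))
        (aeval w₀ (pderiv j (F : MvPolynomial (Fin 3) K))))
    intro y hy
    have hy' : aeval w₀ (a (y, x)) = 0 := hy
    simpa [ha, hw₀] using hy'
  -- a common component
  let B₁ : Fin 3 → Set P := fun l =>
    {g | aeval w₀ (a g) ≠ 0 ∧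
      ∃ y, aeval (chartVec i l t y) (a g) = 0 ∧ aeval (chartVec i l t y) (b g) = 0}
  have hB₁ : ∀ l m : Fin 3, i ≠ l → i ≠ m → l ≠ m → (B₁ l).ncard * Q ≤ (d - 1) * Nat.card P := by
    intro l m hil him hlm
    -- Slices in which only `g.2.1` varies: `a` depends on `g.1` alone, so its generic zeros are a
    -- fixed set of at most `d - 1` points at which `b` moves.
    let e : P ≃ (Forms K ((d - 1) / p) × Forms K (d / p)) × Forms K ((d - 1) / p) :=
      { toFun := fun g => ((g.1, g.2.2), g.2.1)
        invFun := fun g => (g.1.1, g.2, g.1.2)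
        left_inv := fun g => rfl
        right_inv := fun g => rfl }
    refine ncard_mul_le_of_slices e _ fun x => ?_
    by_cases hx : aeval w₀ (a (x.1, 0, x.2)) = 0
    · have : {y | e.symm (x, y) ∈ B₁ l} = ∅ := by
        ext y
        simp only [Set.mem_ofPred_eq, Set.mem_empty_iff_false, iff_false]
        rintro ⟨h, -⟩
        refine h ?_
        rw [ha] at hx ⊢
        exact hx
      simp [this]
    · obtain ⟨s, hs, hs'⟩ := exists_finset_generic_roots ht hil him hlm (hah _) hw₀ hx
      refine le_trans ?_ (Nat.mul_le_mul_right _ hs)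
      refine le_trans (Nat.mul_le_mul_right _ (Set.ncard_le_ncard ?_ (Set.toFinite _)))
        (ncard_iUnion_finset_mul_le s (fun y => {G : Forms K ((d - 1) / p) |
          aeval (chartVec i l t y) (pderiv k (F : MvPolynomial (Fin 3) K)) +
            evalForm _ (chartVec i l t y) G ^ p = 0}) fun y _ => ?_)
      · rintro y ⟨-, z, h1, h2⟩
        refine ⟨z, hs' z ?_, ?_⟩
        · rw [ha] at h1 ⊢
          exact h1
        · rw [hb] at h2
          simp only [map_add, map_mul, map_pow, aeval_X, (chartVec_eq hil him hlm t z).1, one_pow,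
            one_mul] at h2
          exact h2
      · exact ncard_add_pow_eq_zero_mul_le p _ (pow_le_card_range_evalForm
          (chartVec_eq hil him hlm t y).1 le_rfl
          (Or.inl (hinf _ ⟨l, (chartVec_eq hil him hlm t y).2.1⟩))) _
  -- finitely many common zeros
  let B₂ : Set P := {g | aeval w₀ (a g) ≠ 0 ∧ g ∉ B₁ j ∧ g ∉ B₁ k ∧
    ∃ v : Fin 3 → L, v i = 1 ∧ (d - 1) / p + 1 ≤ coordDegree K v ∧ aeval v (a g) = 0 ∧
      aeval v (b g) = 0 ∧
      aeval v ((F + perturb p i j k hd g : Forms K d) : MvPolynomial (Fin 3) K) = 0}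
  have hB₂ : B₂.ncard * Q ≤ B * Nat.card P := by
    -- Now only `g.2.2` varies. It affects neither partial, so their finite set of common zeros is
    -- fixed and only the value of the form moves.
    refine ncard_mul_le_of_slices (Equiv.prodAssoc _ _ _).symm _ fun x => ?_
    have hax : ∀ y, a (x.1, x.2, y) = a (x.1, x.2, 0) := fun y => by rw [ha, ha]
    have hbx : ∀ y, b (x.1, x.2, y) = b (x.1, x.2, 0) := fun y => by rw [hb, hb]
    by_cases hx : aeval w₀ (a (x.1, x.2, 0)) ≠ 0 ∧ (x.1, x.2, 0) ∉ B₁ j ∧ (x.1, x.2, 0) ∉ B₁ k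
    · obtain ⟨h1, h2, h3⟩ := hx
      obtain ⟨s, hs, hs'⟩ := exists_finset_common_zeros ht hij hik hjk (hah (x.1, x.2, 0))
        (hbh (x.1, x.2, 0)) hw₀ h1 (fun y hy => h2 ⟨h1, y, hy⟩) (fun y hy => h3 ⟨h1, y, hy⟩) L
      have hs3 : (s.filter fun v => v i = 1 ∧ (d - 1) / p + 1 ≤ coordDegree K v).card ≤ B :=
        (Finset.card_filter_le _ _).trans hs
      refine le_trans ?_ (Nat.mul_le_mul_right _ hs3)
      refine le_trans (Nat.mul_le_mul_right _ (Set.ncard_le_ncard ?_ (Set.toFinite _)))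
        (ncard_iUnion_finset_mul_le _ (fun v => {H : Forms K (d / p) |
          (aeval v (F : MvPolynomial (Fin 3) K) + (v j * evalForm _ v x.1 ^ p +
            v k * evalForm _ v x.2 ^ p)) + evalForm _ v H ^ p = 0}) fun v hv => ?_)
      · rintro y ⟨-, -, -, v, hv, hdeg, e1, e2, e3⟩
        have e1' : aeval v (a (x.1, x.2, y)) = 0 := e1
        have e2' : aeval v (b (x.1, x.2, y)) = 0 := e2
        rw [hax] at e1'
        rw [hbx] at e2'
        refine ⟨v, Finset.mem_filter.mpr ⟨hs' v hv e1' e2', hv, hdeg⟩, ?_⟩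
        rw [Submodule.coe_add, map_add, aeval_perturb hd _ hv] at e3
        rw [Set.mem_ofPred_eq, add_assoc]
        exact e3
      · obtain ⟨-, hv, hdeg⟩ := Finset.mem_filter.mp hv
        exact ncard_add_pow_eq_zero_mul_le p _ (pow_le_card_range_evalForm hv
          (Nat.succ_le_succ (Nat.div_le_div_right (Nat.sub_le d 1))) (Or.inr hdeg)) _
    · have : {y | (Equiv.prodAssoc _ _ _).symm.symm (x, y) ∈ B₂} = ∅ := by
        ext y
        simp only [Set.mem_ofPred_eq, Set.mem_empty_iff_false, iff_false]
        rintro ⟨h1, h2, h3, -⟩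
        have e : ∀ l, (x.1, x.2, y) ∉ B₁ l → (x.1, x.2, 0) ∉ B₁ l := by
          rintro l hl ⟨h, z, hz⟩
          refine hl ⟨?_, z, ?_⟩
          · rwa [hax]
          · rwa [hax, hbx]
        refine hx ⟨?_, e j h2, e k h3⟩
        have h1' : aeval w₀ (a (x.1, x.2, y)) ≠ 0 := h1
        rwa [hax] at h1'
      rw [this]; simp
  have hsub : {g | ∃ v : Fin 3 → L, v i = 1 ∧ (d - 1) / p + 1 ≤ coordDegree K v ∧
      SingularAt ((F + perturb p i j k hd g : Forms K d) : MvPolynomial (Fin 3) K) v} ⊆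
      B₀ ∪ B₁ j ∪ B₁ k ∪ B₂ := by
    rintro g ⟨v, hv, hdeg, h1, h2⟩
    by_cases g0 : g ∈ B₀
    · exact Or.inl (Or.inl (Or.inl g0))
    by_cases g1 : g ∈ B₁ j
    · exact Or.inl (Or.inl (Or.inr g1))
    by_cases g2 : g ∈ B₁ k
    · exact Or.inl (Or.inr g2)
    exact Or.inr ⟨g0, g1, g2, v, hv, hdeg, h2 j, h2 k, h1⟩
  have hc : {g | ∃ v : Fin 3 → L, v i = 1 ∧ (d - 1) / p + 1 ≤ coordDegree K v ∧
      SingularAt ((F + perturb p i j k hd g : Forms K d) : MvPolynomial (Fin 3) K) v}.ncard ≤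
      B₀.ncard + (B₁ j).ncard + (B₁ k).ncard + B₂.ncard := by
    refine (Set.ncard_le_ncard hsub (Set.toFinite _)).trans ?_
    refine (Set.ncard_union_le _ _).trans (Nat.add_le_add_right ?_ _)
    refine (Set.ncard_union_le _ _).trans (Nat.add_le_add_right ?_ _)
    exact Set.ncard_union_le _ _
  have h1 := hB₁ j k hij hik hjk
  have h2 := hB₁ k j hik hij hjk.symm
  calc _ ≤ (B₀.ncard + (B₁ j).ncard + (B₁ k).ncard + B₂.ncard) * Q := Nat.mul_le_mul_right _ hc
    _ = B₀.ncard * Q + (B₁ j).ncard * Q + (B₁ k).ncard * Q + B₂.ncard * Q := by ring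
    _ ≤ 1 * Nat.card P + (d - 1) * Nat.card P + (d - 1) * Nat.card P + B * Nat.card P := by
      gcongr
    _ = _ := by ring

include hij hik hjk hd in
/-- Few forms are singular at some point of large degree. -/
theorem ncard_exists_singularAt_mul_le (L : Type u) [Field L] [Algebra K L] :
    {F : Forms K d | ∃ v : Fin 3 → L, v i = 1 ∧ (d - 1) / p + 1 ≤ coordDegree K v ∧
        SingularAt (F : MvPolynomial (Fin 3) K) v}.ncard * Nat.card K ^ ((d - 1) / p + 1) ≤
      (1 + 2 * (d - 1) + ((2 * (d - 1) + 1) * (d - 1)) ^ 2) * Nat.card (Forms K d) := by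
  -- The generic line is taken over an algebraic closure of the rational function field.
  have ht : Transcendental K (algebraMap (RatFunc K) (AlgebraicClosure (RatFunc K)) RatFunc.X) := by
    rw [transcendental_algebraMap_iff (algebraMap (RatFunc K) (AlgebraicClosure (RatFunc K))).injective]
    exact RatFunc.transcendental_X
  exact ncard_mul_le_of_translates (perturb p i j k hd) _
    fun F => ncard_perturb_singularAt_mul_le hij hik hjk hd L ht F

end SingularPoints

/-! ### Algebra of the singularity condition -/

section SingularAt

variable {K : Type u} {L : Type v} [Field K] [Field L] [Algebra K L]

theorem aeval_smul_of_isHomogeneous {d : ℕ} {F : MvPolynomial (Fin 3) K} (hF : F.IsHomogeneous d)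
    (c : L) (v : Fin 3 → L) : aeval (c • v) F = c ^ d * aeval v F := by
  rw [aeval_def, aeval_def, eval₂_eq', eval₂_eq', Finset.mul_sum]
  refine Finset.sum_congr rfl fun m hm => ?_
  have hm' : ∑ i, m i = d := by
    rw [hF.degree_eq_sum_deg_support hm, ← Finsupp.degree_apply, Finsupp.degree_eq_sum]
  simp only [Pi.smul_apply, smul_eq_mul, mul_pow, Finset.prod_mul_distrib,
    Finset.prod_pow_eq_pow_sum, hm']
  ring

theorem SingularAt.smul {d : ℕ} {F : MvPolynomial (Fin 3) K} (hF : F.IsHomogeneous d)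
    {v : Fin 3 → L} (h : SingularAt F v) (c : L) : SingularAt F (c • v) :=
  ⟨by rw [aeval_smul_of_isHomogeneous hF, h.1, mul_zero],
    fun i => by rw [aeval_smul_of_isHomogeneous hF.pderiv, h.2 i, mul_zero]⟩

theorem SingularAt.add {F G : MvPolynomial (Fin 3) K} {v : Fin 3 → L} (hF : SingularAt F v)
    (hG : SingularAt G v) : SingularAt (F + G) v :=
  ⟨by rw [map_add, hF.1, hG.1, add_zero], fun i => by
    rw [map_add, map_add, hF.2, hG.2, add_zero]⟩

theorem SingularAt.neg {F : MvPolynomial (Fin 3) K} {v : Fin 3 → L} (hF : SingularAt F v) :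
    SingularAt (-F) v :=
  ⟨by rw [map_neg, hF.1, neg_zero], fun i => by
    rw [map_neg, map_neg, hF.2, neg_zero]⟩

theorem singularAt_zero (v : Fin 3 → L) : SingularAt (0 : MvPolynomial (Fin 3) K) v := by
  simp [SingularAt]

theorem singularAt_sum {ι : Type*} (s : Finset ι) (F : ι → MvPolynomial (Fin 3) K) {v : Fin 3 → L}
    (h : ∀ x ∈ s, SingularAt (F x) v) : SingularAt (∑ x ∈ s, F x) v := by
  classical
  induction s using Finset.induction_on with
  | empty => simpa using singularAt_zero v
  | insert a s ha ih =>
    rw [Finset.sum_insert ha]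
    exact (h a (by simp)).add (ih fun x hx => h x (by simp [hx]))

theorem singularAt_sq_mul {G : MvPolynomial (Fin 3) K} {v : Fin 3 → L} (hG : aeval v G = 0)
    (B : MvPolynomial (Fin 3) K) : SingularAt (G ^ 2 * B) v := by
  constructor
  · simp [hG]
  · intro i
    simp [Derivation.leibniz, Derivation.leibniz_pow, hG]

theorem singularAt_algebraMap_iff {F : MvPolynomial (Fin 3) K} {w : Fin 3 → K} :
    SingularAt F (fun l => algebraMap K L (w l)) ↔ SingularAt F w := by
  have h : ∀ G : MvPolynomial (Fin 3) K,
      aeval (fun l => algebraMap K L (w l)) G = algebraMap K L (aeval w G) := fun G =>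
    aeval_algebraMap_apply L w G
  simp only [SingularAt, h, map_eq_zero_iff _ (algebraMap K L).injective]

theorem coordDegree_algebraMap (w : Fin 3 → K) :
    coordDegree K (fun l => algebraMap K L (w l)) = 1 := by
  refine Subalgebra.finrank_eq_one_iff.mpr (eq_bot_iff.mpr (Algebra.adjoin_le ?_))
  rintro _ ⟨l, rfl⟩
  exact Algebra.mem_bot.mpr ⟨w l, rfl⟩

/-- By Euler's identity, one partial derivative is redundant away from a coordinate line. -/
theorem singularAt_of_two_partials {d : ℕ} {F : MvPolynomial (Fin 3) K} (hF : F.IsHomogeneous d)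
    {v : Fin 3 → L} {i j k : Fin 3} (hij : i ≠ j) (hik : i ≠ k) (hjk : j ≠ k) (hi : v i ≠ 0)
    (h : aeval v F = 0) (hj : aeval v (pderiv j F) = 0) (hk : aeval v (pderiv k F) = 0) :
    SingularAt F v := by
  have he := congrArg (aeval v) hF.sum_X_mul_pderiv
  have hu : (Finset.univ : Finset (Fin 3)) = {i, j, k} := by
    ext l
    simp only [Finset.mem_univ, Finset.mem_insert, Finset.mem_singleton, true_iff]
    omega
  rw [hu, Finset.sum_insert (by simp [hij, hik]), Finset.sum_pair hjk] at he
  simp only [map_add, map_mul, aeval_X, hj, hk, mul_zero, add_zero, map_nsmul, h, smul_zero,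
    mul_eq_zero, hi, false_or] at he
  refine ⟨h, fun l => ?_⟩
  have hl : l = i ∨ l = j ∨ l = k := by omega
  rcases hl with rfl | rfl | rfl <;> assumption

end SingularAt

/-! ### Interpolating jets at rational points -/

section Interpolation

variable {K : Type u} [Field K] [Finite K]

/-- A form not vanishing at the rational point `w`, but at all other points over the fields of
degree at most `r`. -/
noncomputable def separatingForm (w : Fin 3 → K) (i j k : Fin 3) (r : ℕ) :
    MvPolynomial (Fin 3) K :=
  X i * ∏ e ∈ Finset.Icc 1 r,
    ((X i ^ (Nat.card K ^ e - 1) - (C (w i) * X j - C (w j) * X i) ^ (Nat.card K ^ e - 1)) *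
      (X i ^ (Nat.card K ^ e - 1) - (C (w i) * X k - C (w k) * X i) ^ (Nat.card K ^ e - 1)))

omit [Finite K] in
theorem isHomogeneous_separatingForm (w : Fin 3 → K) (i j k : Fin 3) (r : ℕ) :
    (separatingForm w i j k r).IsHomogeneous
      (1 + ∑ e ∈ Finset.Icc 1 r, ((Nat.card K ^ e - 1) + (Nat.card K ^ e - 1))) := by
  have hl : ∀ l : Fin 3, (C (w i) * X l - C (w l) * X i : MvPolynomial (Fin 3) K).IsHomogeneous 1 :=
    fun l => ((isHomogeneous_X K l).C_mul _).sub ((isHomogeneous_X K i).C_mul _)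
  have hf : ∀ (l : Fin 3) (m : ℕ), (X i ^ m - (C (w i) * X l - C (w l) * X i) ^ m :
      MvPolynomial (Fin 3) K).IsHomogeneous m := fun l m => by
    have h1 := (isHomogeneous_X K i).pow m
    have h2 := (hl l).pow m
    rw [one_mul] at h1 h2
    exact h1.sub h2
  exact (isHomogeneous_X K i).mul (IsHomogeneous.prod _ _ _ fun e _ => (hf j _).mul (hf k _))

theorem aeval_separatingForm_self {w : Fin 3 → K} {i : Fin 3} (hi : w i ≠ 0) (j k : Fin 3) (r : ℕ) :
    aeval w (separatingForm w i j k r) ≠ 0 := by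
  have hq : 1 < Nat.card K := Finite.one_lt_card
  simp only [separatingForm, map_mul, map_prod, map_sub, map_pow, aeval_X, aeval_C,
    Algebra.algebraMap_self, RingHom.id_apply]
  refine mul_ne_zero hi (Finset.prod_ne_zero_iff.mpr fun e he => ?_)
  have he : Nat.card K ^ e - 1 ≠ 0 := by
    have := Nat.one_lt_pow (Nat.one_le_iff_ne_zero.mp (Finset.mem_Icc.mp he).1) hq
    omega
  have h : ∀ l, w i * w l - w l * w i = 0 := fun l => by ring
  simp [h, he, hi]

/-- Nonzero elements fixed by the `q ^ e`-power map have `(q ^ e - 1)`-th power `1`. If `v i ≠ 0`,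
the factor at `e` therefore survives only when both linear forms vanish at `v`, which makes `v`
proportional to `w`; if `v i = 0`, the leading `X i` vanishes. -/
theorem aeval_separatingForm_eq_zero {L : Type v} [Field L] [Algebra K L] {w : Fin 3 → K}
    {i j k : Fin 3} (hij : i ≠ j) (hik : i ≠ k) (hjk : j ≠ k) (hi : w i ≠ 0) {r e : ℕ}
    (he : e ∈ Finset.Icc 1 r) {v : Fin 3 → L} (hv : ∀ l, v l ^ Nat.card K ^ e = v l)
    (hvw : ∀ c : L, v ≠ c • fun l => algebraMap K L (w l)) :
    aeval v (separatingForm w i j k r) = 0 := by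
  have := Fintype.ofFinite K
  have hq : 0 < Nat.card K ^ e := pow_pos Nat.card_pos e
  have hpow : ∀ x : L, x ^ Nat.card K ^ e = x → x ≠ 0 → x ^ (Nat.card K ^ e - 1) = 1 := by
    intro x hx hx0
    refine mul_left_cancel₀ hx0 ?_
    rw [mul_one, ← pow_succ', Nat.sub_add_cancel hq, hx]
  obtain ⟨p, hp⟩ := CharP.exists K
  have hpp : Fact p.Prime := ⟨CharP.char_is_prime K p⟩
  obtain ⟨n, -, hn⟩ := FiniteField.card K p
  have : CharP L p := charP_of_injective_algebraMap (algebraMap K L).injective p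
  have hKe : ∀ a : K, a ^ Nat.card K ^ e = a := fun a => by
    rw [Nat.card_eq_fintype_card]; exact FiniteField.pow_card_pow e a
  have hfix : ∀ l, (algebraMap K L (w i) * v l - algebraMap K L (w l) * v i) ^ Nat.card K ^ e =
      algebraMap K L (w i) * v l - algebraMap K L (w l) * v i := by
    intro l
    rw [Nat.card_eq_fintype_card, hn, ← pow_mul, sub_pow_char_pow, mul_pow, mul_pow,
      ← map_pow, ← map_pow, pow_mul, ← hn, ← Nat.card_eq_fintype_card, hKe, hKe, hv, hv]
  simp only [separatingForm, map_mul, map_prod, map_sub, map_pow, aeval_X, aeval_C]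
  by_cases hvi : v i = 0
  · rw [hvi, zero_mul]
  refine mul_eq_zero_of_right _ (Finset.prod_eq_zero he ?_)
  by_contra hne
  rw [mul_eq_zero, not_or] at hne
  have hz : ∀ l, v i ^ (Nat.card K ^ e - 1) -
      (algebraMap K L (w i) * v l - algebraMap K L (w l) * v i) ^ (Nat.card K ^ e - 1) ≠ 0 →
      algebraMap K L (w i) * v l = algebraMap K L (w l) * v i := by
    intro l hl
    by_contra h
    refine hl ?_
    rw [hpow _ (hv i) hvi, hpow _ (hfix l) (sub_ne_zero.mpr h), sub_self]
  have hwi : algebraMap K L (w i) ≠ 0 := (map_ne_zero _).mpr hi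
  refine hvw (v i / algebraMap K L (w i)) (funext fun l => ?_)
  have hl : l = i ∨ l = j ∨ l = k := by omega
  have : algebraMap K L (w i) * v l = algebraMap K L (w l) * v i := by
    rcases hl with rfl | rfl | rfl
    · rw [mul_comm]
    · exact hz _ hne.1
    · exact hz _ hne.2
  simp only [Pi.smul_apply, smul_eq_mul]
  field_simp
  linear_combination this

theorem sum_card_pow_sub_one_le {q : ℕ} (hq : 2 ≤ q) (r : ℕ) :
    ∑ e ∈ Finset.Icc 1 r, ((q ^ e - 1) + (q ^ e - 1)) ≤ 4 * q ^ r := by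
  induction r with
  | zero => simp
  | succ r ih =>
    rw [Finset.sum_Icc_succ_top (by omega)]
    have : q ^ (r + 1) = q ^ r * q := pow_succ q r
    have : q ^ r * 2 ≤ q ^ r * q := Nat.mul_le_mul_left _ hq
    omega

/-- Prescribing the first-order behaviour at a rational point, with vanishing to second order at
all other points of small degree. -/
theorem exists_form_with_jet {w : Fin 3 → K} {i j k : Fin 3} (hij : i ≠ j) (hik : i ≠ k)
    (hjk : j ≠ k) (hi : w i ≠ 0) {r d : ℕ} (hd : 8 * Nat.card K ^ r + 3 ≤ d) (α β δ : K) :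
    ∃ F : Forms K d, aeval w (F : MvPolynomial (Fin 3) K) = α ∧
      aeval w (pderiv j (F : MvPolynomial (Fin 3) K)) = β ∧
      aeval w (pderiv k (F : MvPolynomial (Fin 3) K)) = δ ∧
      ∀ (L : Type u) [Field L] [Algebra K L] (v : Fin 3 → L),
        (∃ e ∈ Finset.Icc 1 r, ∀ l, v l ^ Nat.card K ^ e = v l) →
        (∀ c : L, v ≠ c • fun l => algebraMap K L (w l)) →
        SingularAt (F : MvPolynomial (Fin 3) K) v := by
  set G := separatingForm w i j k r with hG
  set D := 1 + ∑ e ∈ Finset.Icc 1 r, ((Nat.card K ^ e - 1) + (Nat.card K ^ e - 1)) with hD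
  -- As `D ≤ 1 + 4 q ^ r`, the square of `G` and one linear factor fit into degree `8 q ^ r + 3`; a
  -- power of `X i` fills the remaining degree.
  have hDd : D * 2 + (1 * (d - 1 - D * 2) + 1) = d := by
    have := sum_card_pow_sub_one_le (Finite.one_lt_card (α := K)) r
    omega
  set n := d - 1 - D * 2 with hn
  set g := aeval w G with hg
  have hg0 : g ≠ 0 := aeval_separatingForm_self hi j k r
  have hw0 : w i ^ n ≠ 0 := pow_ne_zero _ hi
  -- With the value at `w` fixed, the Leibniz rule makes each prescribed partial a linear equation
  -- for `b` or `c`; then `a` restores the value, since `w i ≠ 0`.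
  set b := (β - aeval w (pderiv j (G ^ 2)) * (α / g ^ 2)) / (g ^ 2 * w i ^ n) with hb
  set c := (δ - aeval w (pderiv k (G ^ 2)) * (α / g ^ 2)) / (g ^ 2 * w i ^ n) with hc
  set a := (α / (g ^ 2 * w i ^ n) - b * w j - c * w k) / w i with ha
  set l : MvPolynomial (Fin 3) K := C a * X i + C b * X j + C c * X k with hl
  have hlh : l.IsHomogeneous 1 := (((isHomogeneous_X K i).C_mul _).add
    ((isHomogeneous_X K j).C_mul _)).add ((isHomogeneous_X K k).C_mul _)
  have hFh : (G ^ 2 * (X i ^ n * l)).IsHomogeneous d := by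
    have := ((isHomogeneous_separatingForm w i j k r).pow 2).mul
      (((isHomogeneous_X K i).pow n).mul hlh)
    rwa [← hD, hDd] at this
  have hlw : aeval w l = α / (g ^ 2 * w i ^ n) := by
    simp only [hl, map_add, map_mul, aeval_X, aeval_C, Algebra.algebraMap_self, RingHom.id_apply,
      ha]
    field_simp
    ring
  have hjl : aeval w (pderiv j (X i ^ n * l)) = w i ^ n * b := by
    simp [hl, Derivation.leibniz, Derivation.leibniz_pow, pderiv_X_of_ne hij,
      pderiv_X_of_ne hjk.symm]
  have hkl : aeval w (pderiv k (X i ^ n * l)) = w i ^ n * c := by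
    simp [hl, Derivation.leibniz, Derivation.leibniz_pow, pderiv_X_of_ne hik,
      pderiv_X_of_ne hjk]
  have hval : aeval w (X i ^ n * l) = α / g ^ 2 := by
    rw [map_mul, map_pow, aeval_X, hlw]; field_simp
  refine ⟨⟨G ^ 2 * (X i ^ n * l), hFh⟩, ?_, ?_, ?_, ?_⟩
  · change aeval w (G ^ 2 * (X i ^ n * l)) = α
    rw [map_mul, hval, map_pow, ← hg]; field_simp
  · change aeval w (pderiv j (G ^ 2 * (X i ^ n * l))) = β
    rw [Derivation.leibniz, map_add, smul_eq_mul, smul_eq_mul, map_mul (aeval w), map_mul (aeval w),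
      hval, hjl,
      map_pow, ← hg, hb]
    field_simp
    ring
  · change aeval w (pderiv k (G ^ 2 * (X i ^ n * l))) = δ
    rw [Derivation.leibniz, map_add, smul_eq_mul, smul_eq_mul, map_mul (aeval w), map_mul (aeval w),
      hval, hkl,
      map_pow, ← hg, hc]
    field_simp
    ring
  · rintro L _ _ v ⟨e, he, hv⟩ hvw
    exact singularAt_sq_mul (aeval_separatingForm_eq_zero hij hik hjk hi he hv hvw) _

end Interpolation

/-! ### Equidistribution from translation invariance -/

section Equidistribution

/-- `U` need not be a subgroup: translations preserving `U` inject each fibre of `J` on `U` into any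
other, so all fibres have the same size. -/
theorem ncard_mul_card_of_translation_invariant {A B : Type*} [AddCommGroup A] [Finite A]
    [AddCommGroup B] [Finite B] (J : A →+ B) (U : Set A)
    (hU : ∀ b, ∃ h, J h = b ∧ ∀ F ∈ U, F + h ∈ U) (S : Set B) :
    {F | F ∈ U ∧ J F ∈ S}.ncard * Nat.card B = U.ncard * S.ncard := by
  classical
  have := Fintype.ofFinite B
  have hle : ∀ b b', {F | F ∈ U ∧ J F = b}.ncard ≤ {F | F ∈ U ∧ J F = b'}.ncard := by
    intro b b'
    obtain ⟨h, hh, hU'⟩ := hU (b' - b)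
    refine Set.ncard_le_ncard_of_injOn (fun F => F + h) ?_ ?_ (Set.toFinite _)
    · rintro F ⟨h1, rfl⟩
      exact ⟨hU' F h1, by rw [map_add, hh]; abel⟩
    · intro x _ y _ hxy
      exact add_right_cancel hxy
  have hsum : ∀ S : Set B, {F | F ∈ U ∧ J F ∈ S}.ncard =
      S.ncard * {F | F ∈ U ∧ J F = 0}.ncard := by
    intro S
    have h1 : Nat.card {F | F ∈ U ∧ J F ∈ S} = Nat.card (Σ b : S, {F | F ∈ U ∧ J F = b}) :=
      Nat.card_congr
        { toFun := fun a => ⟨⟨J a.1, a.2.2⟩, a.1, a.2.1, rfl⟩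
          invFun := fun s => ⟨s.2.1, s.2.2.1, by rw [s.2.2.2]; exact s.1.2⟩
          left_inv := fun a => rfl
          right_inv := by
            rintro ⟨⟨b, hb⟩, F, hF, h⟩
            have h' : J F = b := h
            subst h'
            rfl }
    have := Fintype.ofFinite S
    have h2 : ∀ b : S, Nat.card {F | F ∈ U ∧ J F = b} = {F | F ∈ U ∧ J F = 0}.ncard :=
      fun b => le_antisymm (hle _ _) (hle _ _)
    rw [Nat.card_sigma, Finset.sum_congr rfl fun b _ => h2 b, Finset.sum_const, Finset.card_univ,
      ← Nat.card_eq_fintype_card, smul_eq_mul] at h1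
    exact h1
  have h2 := hsum Set.univ
  simp only [Set.mem_univ, and_true, Set.ncard_univ] at h2
  have h3 : {F | F ∈ U} = U := rfl
  rw [h3] at h2
  rw [hsum S, h2]; ring

end Equidistribution

/-! ### Density of forms singular at points of degree above `s` -/

noncomputable section

/-- The last nonzero coordinate of `v` is `1`. -/
def IsNormalized {L : Type v} [Field L] (v : Fin 3 → L) : Prop :=
  v 2 = 1 ∨ (v 2 = 0 ∧ v 1 = 1) ∨ (v 2 = 0 ∧ v 1 = 0 ∧ v 0 = 1)

/-- Forms singular at some point of degree more than `s`. -/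
def singularForms (K : Type u) [Field K] (d s : ℕ) : Set (Forms K d) :=
  {F | ∃ v : Fin 3 → AlgebraicClosure K, IsNormalized v ∧ s < coordDegree K v ∧
    SingularAt (F : MvPolynomial (Fin 3) K) v}

/-- Forms nonsingular at all nonrational points of degree at most `r`. -/
def nonsingularForms (K : Type u) [Field K] (d r : ℕ) : Set (Forms K d) :=
  {F | ∀ v : Fin 3 → AlgebraicClosure K, IsNormalized v → 1 < coordDegree K v →
    coordDegree K v ≤ r → ¬ SingularAt (F : MvPolynomial (Fin 3) K) v}

/-- Bound for the density of forms singular at a point of large degree. -/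
def highDegreeBound (q d : ℕ) : ℝ :=
  3 * (1 + 2 * d + ((2 * d + 1) * d) ^ 2 : ℕ) / (q : ℝ) ^ ((d - 1) / q + 1)

end

section Bounds

theorem IsNormalized.exists_eq_one {L : Type v} [Field L] {v : Fin 3 → L} (h : IsNormalized v) :
    ∃ i, v i = 1 := by
  rcases h with h | h | h
  exacts [⟨2, h⟩, ⟨1, h.2⟩, ⟨0, h.2.2⟩]

theorem exists_isNormalized_smul {L : Type v} [Field L] {v : Fin 3 → L} (hv : v ≠ 0) :
    ∃ c : L, c ≠ 0 ∧ IsNormalized (c • v) := by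
  by_cases h2 : v 2 = 0
  · by_cases h1 : v 1 = 0
    · have h0 : v 0 ≠ 0 := fun h0 => hv (funext fun l => by fin_cases l <;> assumption)
      exact ⟨(v 0)⁻¹, inv_ne_zero h0, Or.inr (Or.inr (by simp [h0, h1, h2]))⟩
    · exact ⟨(v 1)⁻¹, inv_ne_zero h1, Or.inr (Or.inl (by simp [h1, h2]))⟩
  · exact ⟨(v 2)⁻¹, inv_ne_zero h2, Or.inl (by simp [h2])⟩

variable {K : Type u} [Field K] [Finite K]

/-- There are at most `q ^ (2 * e) + q ^ e` nonrational points of degree `e`. -/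
theorem exists_finset_points (L : Type v) [Field L] [Algebra K L] [Algebra.IsAlgebraic K L]
    {e : ℕ} (he : 1 < e) :
    ∃ s : Finset (Fin 3 → L), s.card ≤ Nat.card K ^ (2 * e) + Nat.card K ^ e ∧
      (∀ v ∈ s, IsNormalized v ∧ coordDegree K v = e) ∧
      ∀ v : Fin 3 → L, IsNormalized v → coordDegree K v = e → v ∈ s := by
  classical
  have hq : 1 < Nat.card K := Finite.one_lt_card
  have hqe : 1 < Nat.card K ^ e := Nat.one_lt_pow (by omega) hq
  let P : Polynomial L := Polynomial.X ^ (Nat.card K ^ e) - Polynomial.X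
  have hP0 : P ≠ 0 := FiniteField.X_pow_card_sub_X_ne_zero L hqe
  let f : Finset L := P.roots.toFinset
  have hf : f.card ≤ Nat.card K ^ e := by
    refine (Multiset.toFinset_card_le _).trans ((Polynomial.card_roots' _).trans ?_)
    rw [FiniteField.X_pow_card_sub_X_natDegree_eq L hqe]
  have hmem : ∀ v : Fin 3 → L, coordDegree K v = e → ∀ l, v l ∈ f := by
    intro v hv l
    rw [Multiset.mem_toFinset, Polynomial.mem_roots hP0]
    have := pow_card_coordDegree (K := K) v l
    rw [hv] at this
    simp [P, this]
  let s := (f ×ˢ f).image (fun z => ![z.1, z.2, (1 : L)]) ∪ f.image (fun z => ![z, (1 : L), 0])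
  refine ⟨s.filter fun v => IsNormalized v ∧ coordDegree K v = e, ?_,
    fun v hv => (Finset.mem_filter.mp hv).2, fun v hn hv => Finset.mem_filter.mpr ⟨?_, hn, hv⟩⟩
  · refine (Finset.card_filter_le _ _).trans ((Finset.card_union_le _ _).trans
      (add_le_add ?_ (Finset.card_image_le.trans hf)))
    refine Finset.card_image_le.trans ?_
    rw [Finset.card_product, two_mul, pow_add]
    exact Nat.mul_le_mul hf hf
  · rcases hn with h | ⟨h2, h1⟩ | ⟨h2, h1, h0⟩
    · refine Finset.mem_union_left _ (Finset.mem_image.mpr ⟨(v 0, v 1),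
        Finset.mk_mem_product (hmem v hv 0) (hmem v hv 1), ?_⟩)
      ext l; fin_cases l <;> simp [h]
    · refine Finset.mem_union_right _ (Finset.mem_image.mpr ⟨v 0, hmem v hv 0, ?_⟩)
      ext l; fin_cases l <;> simp [h2, h1]
    -- The remaining normalized point `(1, 0, 0)` is rational, excluded by `1 < e`.
    · exfalso
      have : v = fun l => algebraMap K L (![1, 0, 0] l) := by
        ext l; fin_cases l <;> simp [h2, h1, h0]
      rw [this, coordDegree_algebraMap] at hv
      omega

theorem exists_chart (i : Fin 3) : ∃ j k : Fin 3, i ≠ j ∧ i ≠ k ∧ j ≠ k :=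
  ⟨i + 1, i + 2, by fin_cases i <;> decide⟩

theorem sum_geometric_le {q : ℕ} (hq : 2 ≤ q) (s n : ℕ) :
    ∑ e ∈ Finset.Ioc s n, (((q : ℝ) ^ e)⁻¹ + (((q : ℝ) ^ e)⁻¹) ^ 2) ≤
      ((q : ℝ) ^ s)⁻¹ + (((q : ℝ) ^ s)⁻¹) ^ 2 / 3 := by
  have hq' : (2 : ℝ) ≤ q := by exact_mod_cast hq
  rcases le_total n s with h | h
  · rw [Finset.Ioc_eq_empty (by omega), Finset.sum_empty]; positivity
  -- Subtracting the same expression at `n` lets the induction close. The constants `1` and `1 / 3`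
  -- are the geometric sums for `q = 2`, the worst case.
  suffices ∑ e ∈ Finset.Ioc s n, (((q : ℝ) ^ e)⁻¹ + (((q : ℝ) ^ e)⁻¹) ^ 2) ≤
      ((q : ℝ) ^ s)⁻¹ + (((q : ℝ) ^ s)⁻¹) ^ 2 / 3 -
        (((q : ℝ) ^ n)⁻¹ + (((q : ℝ) ^ n)⁻¹) ^ 2 / 3) by
    have h0 : 0 ≤ ((q : ℝ) ^ n)⁻¹ + (((q : ℝ) ^ n)⁻¹) ^ 2 / 3 := by positivity
    linarith
  induction n, h using Nat.le_induction with
  | base => simp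
  | succ n hn ih =>
    rw [← Finset.insert_Ioc_right_eq_Ioc_add_one (by omega), Finset.sum_insert (by simp)]
    have hy : (q : ℝ)⁻¹ ≤ 2⁻¹ := inv_anti₀ (by norm_num) hq'
    have hy0 : 0 ≤ (q : ℝ)⁻¹ := by positivity
    set x := ((q : ℝ) ^ n)⁻¹ with hx
    have hx0 : 0 ≤ x := by positivity
    have e : ((q : ℝ) ^ (n + 1))⁻¹ = x * (q : ℝ)⁻¹ := by rw [pow_succ, mul_inv]
    rw [e]
    have h1 : x * (q : ℝ)⁻¹ ≤ x * 2⁻¹ := mul_le_mul_of_nonneg_left hy hx0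
    have h2 : (x * (q : ℝ)⁻¹) ^ 2 ≤ (x * 2⁻¹) ^ 2 := pow_le_pow_left₀ (by positivity) h1 2
    nlinarith

/-- Up to degree `(d - 1) / p + 1` there are at most `q ^ (2 * e) + q ^ e` points of degree `e`,
each of cost `q ^ (-3 * e)`. Larger degrees are handled by the perturbation bound in each of three
charts, so no intermediate range is left. -/
theorem ncard_singularForms_le {d : ℕ} (hd : 1 ≤ d) {s : ℕ} (hs : 1 ≤ s) :
    ((singularForms K d s).ncard : ℝ) ≤
      (((Nat.card K : ℝ) ^ s)⁻¹ + (((Nat.card K : ℝ) ^ s)⁻¹) ^ 2 / 3 +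
        highDegreeBound (Nat.card K) d) * Nat.card (Forms K d) := by
  classical
  obtain ⟨p, hp⟩ := CharP.exists K
  have hpp : Fact p.Prime := ⟨CharP.char_is_prime K p⟩
  set q := Nat.card K with hqdef
  have hq : 2 ≤ q := Finite.one_lt_card
  have hpq : p ≤ q := by
    have := Fintype.ofFinite K
    obtain ⟨n, -, hn⟩ := FiniteField.card K p
    rw [hqdef, Nat.card_eq_fintype_card, hn]
    exact Nat.le_self_pow n.ne_zero p
  set γ := (d - 1) / p with hγ
  have hqR : (0 : ℝ) < q := by positivity
  have : Finite (Forms K d) := finite_forms d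
  set T : ℝ := (Nat.card (Forms K d) : ℝ) with hT
  have hT0 : 0 ≤ T := by positivity
  let A : ℕ → Set (Forms K d) := fun e =>
    {F | ∃ v : Fin 3 → AlgebraicClosure K, IsNormalized v ∧ coordDegree K v = e ∧
      SingularAt (F : MvPolynomial (Fin 3) K) v}
  let H : Fin 3 → Set (Forms K d) := fun i =>
    {F | ∃ v : Fin 3 → AlgebraicClosure K, v i = 1 ∧ γ + 1 ≤ coordDegree K v ∧
      SingularAt (F : MvPolynomial (Fin 3) K) v}
  have hsub : singularForms K d s ⊆ {F | ∃ e ∈ Finset.Ioc s (γ + 1), F ∈ A e} ∪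
      {F | ∃ i ∈ (Finset.univ : Finset (Fin 3)), F ∈ H i} := by
    rintro F ⟨v, hv, hsv, hF⟩
    by_cases h : coordDegree K v ≤ γ + 1
    · exact Or.inl ⟨_, Finset.mem_Ioc.mpr ⟨hsv, h⟩, v, hv, rfl, hF⟩
    · obtain ⟨i, hi⟩ := hv.exists_eq_one
      exact Or.inr ⟨i, Finset.mem_univ _, v, hi, by omega, hF⟩
  have hA : ∀ e ∈ Finset.Ioc s (γ + 1),
      ((A e).ncard : ℝ) ≤ (((q : ℝ) ^ e)⁻¹ + (((q : ℝ) ^ e)⁻¹) ^ 2) * T := by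
    intro e he
    rw [Finset.mem_Ioc] at he
    obtain ⟨t, ht, ht1, ht2⟩ := exists_finset_points (K := K) (AlgebraicClosure K) (e := e)
      (by omega)
    have h1 := ncard_iUnion_finset_mul_le t
      (fun v => {F : Forms K d | SingularAt (F : MvPolynomial (Fin 3) K) v})
      (Q := q ^ (3 * e)) (N := Nat.card (Forms K d)) (fun v hv => by
        obtain ⟨hv1, hv2⟩ := ht1 v hv
        obtain ⟨i, hi⟩ := hv1.exists_eq_one
        obtain ⟨j, k, hij, hik, hjk⟩ := exists_chart i
        have := ncard_singularAt_mul_le hij hik hjk hd (p := p) hi (by rw [hv2]; exact he.2)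
        rwa [hv2] at this)
    have h2 : (A e).ncard ≤ {F : Forms K d | ∃ v ∈ t,
        F ∈ {F : Forms K d | SingularAt (F : MvPolynomial (Fin 3) K) v}}.ncard :=
      Set.ncard_le_ncard (by
        rintro F ⟨v, hv, hve, hF⟩
        exact ⟨v, ht2 v hv hve, hF⟩) (Set.toFinite _)
    have h3 : (A e).ncard * q ^ (3 * e) ≤ (q ^ (2 * e) + q ^ e) * Nat.card (Forms K d) :=
      (Nat.mul_le_mul_right _ h2).trans (h1.trans (Nat.mul_le_mul_right _ ht))
    have h4 : ((A e).ncard : ℝ) * (q : ℝ) ^ (3 * e) ≤ ((q : ℝ) ^ (2 * e) + (q : ℝ) ^ e) * T := by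
      rw [hT]; exact_mod_cast h3
    have hx : (0 : ℝ) < (q : ℝ) ^ e := by positivity
    rw [mul_comm 3, mul_comm 2, pow_mul, pow_mul] at h4
    rw [← le_div_iff₀ (by positivity)] at h4
    refine h4.trans (le_of_eq ?_)
    field_simp
  have hH : ∀ i, ((H i).ncard : ℝ) ≤ highDegreeBound q d / 3 * T := by
    intro i
    obtain ⟨j, k, hij, hik, hjk⟩ := exists_chart i
    have h1 := ncard_exists_singularAt_mul_le (K := K) hij hik hjk hd (p := p) (AlgebraicClosure K)
    have h2 : ((H i).ncard : ℝ) * (q : ℝ) ^ (γ + 1) ≤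
        ((1 + 2 * d + ((2 * d + 1) * d) ^ 2 : ℕ) : ℝ) * T := by
      have : (H i).ncard * q ^ (γ + 1) ≤
          (1 + 2 * d + ((2 * d + 1) * d) ^ 2) * Nat.card (Forms K d) := by
        refine h1.trans (Nat.mul_le_mul_right _ ?_)
        gcongr <;> omega
      rw [hT]; exact_mod_cast this
    -- Replacing `p` by `q ≥ p` weakens the bound but makes it depend on `q` and `d` only.
    have h3 : (q : ℝ) ^ ((d - 1) / q + 1) ≤ (q : ℝ) ^ (γ + 1) :=
      pow_le_pow_right₀ (by exact_mod_cast (by omega : 1 ≤ q))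
        (Nat.succ_le_succ (Nat.div_le_div_left hpq hpp.out.pos))
    have h4 : ((H i).ncard : ℝ) * (q : ℝ) ^ ((d - 1) / q + 1) ≤
        ((1 + 2 * d + ((2 * d + 1) * d) ^ 2 : ℕ) : ℝ) * T :=
      (mul_le_mul_of_nonneg_left h3 (by positivity)).trans h2
    rw [← le_div_iff₀ (by positivity)] at h4
    refine h4.trans (le_of_eq ?_)
    rw [highDegreeBound]
    field_simp
  have hU : ∀ {ι : Type} (t : Finset ι) (B : ι → Set (Forms K d)),
      ({F | ∃ x ∈ t, F ∈ B x}.ncard : ℝ) ≤ ∑ x ∈ t, ((B x).ncard : ℝ) := by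
    intro ι t B
    have : {F | ∃ x ∈ t, F ∈ B x} = ⋃ x ∈ t, B x := by ext; simp
    rw [this]
    exact_mod_cast Finset.set_ncard_biUnion_le t B
  calc ((singularForms K d s).ncard : ℝ)
      ≤ (({F | ∃ e ∈ Finset.Ioc s (γ + 1), F ∈ A e} ∪
        {F | ∃ i ∈ (Finset.univ : Finset (Fin 3)), F ∈ H i}).ncard : ℝ) := by
        exact_mod_cast Set.ncard_le_ncard hsub (Set.toFinite _)
    _ ≤ ({F | ∃ e ∈ Finset.Ioc s (γ + 1), F ∈ A e}.ncard : ℝ) +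
        ({F | ∃ i ∈ (Finset.univ : Finset (Fin 3)), F ∈ H i}.ncard : ℝ) := by
        exact_mod_cast Set.ncard_union_le _ _
    _ ≤ ∑ e ∈ Finset.Ioc s (γ + 1), (((q : ℝ) ^ e)⁻¹ + (((q : ℝ) ^ e)⁻¹) ^ 2) * T +
        ∑ _i : Fin 3, highDegreeBound q d / 3 * T :=
        add_le_add ((hU _ _).trans (Finset.sum_le_sum hA))
          ((hU _ _).trans (Finset.sum_le_sum fun i _ => hH i))
    _ ≤ _ := by
        rw [← Finset.sum_mul, Finset.sum_const, Finset.card_univ, Fintype.card_fin, add_mul]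
        refine add_le_add (mul_le_mul_of_nonneg_right (sum_geometric_le hq _ _) hT0)
          (le_of_eq ?_)
        rw [nsmul_eq_mul]; push_cast; ring

end Bounds

/-! ### Jets at rational points and the sieve -/

noncomputable section

variable {K : Type u} [Field K]

/-- The index of a nonzero homogeneous coordinate of `P`. -/
def chartIndex (P : ℙ K (Fin 3 → K)) : Fin 3 :=
  (Function.ne_iff.mp P.rep_nonzero).choose

theorem rep_chartIndex_ne_zero (P : ℙ K (Fin 3 → K)) : P.rep (chartIndex P) ≠ 0 :=
  (Function.ne_iff.mp P.rep_nonzero).choose_spec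

/-- The values at the rational points of a form and two of its partial derivatives. -/
def rationalJets (K : Type u) [Field K] (d : ℕ) :
    Forms K d →+ (ℙ K (Fin 3 → K) → K × K × K) where
  toFun F P := (aeval P.rep (F : MvPolynomial (Fin 3) K),
    aeval P.rep (pderiv (chartIndex P + 1) (F : MvPolynomial (Fin 3) K)),
    aeval P.rep (pderiv (chartIndex P + 2) (F : MvPolynomial (Fin 3) K)))
  map_zero' := by ext <;> simp
  map_add' F G := by ext <;> simp

end

section Main

variable {K : Type u} [Field K]

theorem chart_ne (i : Fin 3) : i ≠ i + 1 ∧ i ≠ i + 2 ∧ i + 1 ≠ i + 2 := by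
  fin_cases i <;> decide

theorem rationalJets_eq_zero_iff {d : ℕ} (F : Forms K d) (P : ℙ K (Fin 3 → K)) :
    rationalJets K d F P = 0 ↔ SingularAt (F : MvPolynomial (Fin 3) K) P.rep := by
  obtain ⟨h1, h2, h3⟩ := chart_ne (chartIndex P)
  constructor
  · intro h
    simp only [rationalJets, AddMonoidHom.coe_mk, ZeroHom.coe_mk, Prod.mk_eq_zero] at h
    exact singularAt_of_two_partials F.2 h1 h2 h3 (rep_chartIndex_ne_zero P) h.1 h.2.1 h.2.2
  · intro h
    exact Prod.ext h.1 (Prod.ext (h.2 _) (h.2 _))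

theorem mem_rationalPoints_iff {d : ℕ} (F : Forms K d) (P : ℙ K (Fin 3 → K)) :
    P ∈ rationalPoints (F : MvPolynomial (Fin 3) K) ↔ (rationalJets K d F P).1 = 0 := by
  simp [rationalPoints, rationalJets, aeval_eq_eval]

variable [Finite K]

/-- Singularity is invariant under scaling, so points may be normalized; those of degree one are the
rational points, where the jets decide. -/
theorem definesSmoothPlaneCurve_iff {d : ℕ} (F : Forms K d) :
    DefinesSmoothPlaneCurve (F : MvPolynomial (Fin 3) K) ↔
      F ∉ singularForms K d 1 ∧ ∀ P, rationalJets K d F P ≠ 0 := by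
  constructor
  · intro h
    refine ⟨?_, fun P hP => ?_⟩
    · rintro ⟨v, hv, -, hF⟩
      obtain ⟨i, hi⟩ := hv.exists_eq_one
      exact h v (fun h0 => by simp [h0] at hi) hF
    · rw [rationalJets_eq_zero_iff] at hP
      refine h (fun l => algebraMap K _ (P.rep l)) (fun h0 => P.rep_nonzero (funext fun l => ?_))
        (singularAt_algebraMap_iff.mpr hP)
      simpa using congrFun h0 l
  · rintro ⟨h1, h2⟩ x hx hF
    obtain ⟨c, hc, hn⟩ := exists_isNormalized_smul hx
    have hs : SingularAt (F : MvPolynomial (Fin 3) K) (c • x) := SingularAt.smul F.2 hF c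
    rcases (coordDegree_pos (K := K) (c • x)).eq_or_lt with h | h
    · obtain ⟨w, hw⟩ := exists_algebraMap_of_coordDegree_eq_one h.symm
      rw [hw, singularAt_algebraMap_iff] at hs
      have hw0 : w ≠ 0 := by
        rintro rfl
        have : c • x = 0 := by rw [hw]; ext l; simp
        exact (smul_ne_zero hc hx) this
      obtain ⟨a, ha⟩ := Projectivization.exists_smul_eq_mk_rep K w hw0
      refine h2 (Projectivization.mk K w hw0) ((rationalJets_eq_zero_iff F _).mpr ?_)
      rw [← ha]
      exact hs.smul F.2 (a : K)
    · exact h1 ⟨c • x, hn, h, hs⟩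

/-- Arbitrary behaviour at rational points can be realised without affecting the behaviour at
nonrational points of small degree. -/
theorem exists_translation {d r : ℕ} (hr : 1 ≤ r) (hd : 8 * Nat.card K ^ r + 3 ≤ d)
    (b : ℙ K (Fin 3 → K) → K × K × K) :
    ∃ h : Forms K d, rationalJets K d h = b ∧
      ∀ F ∈ nonsingularForms K d r, F + h ∈ nonsingularForms K d r := by
  classical
  have := Fintype.ofFinite (ℙ K (Fin 3 → K))
  have key := fun P : ℙ K (Fin 3 → K) =>
    exists_form_with_jet (chart_ne (chartIndex P)).1 (chart_ne (chartIndex P)).2.1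
      (chart_ne (chartIndex P)).2.2 (rep_chartIndex_ne_zero P) hd (b P).1 (b P).2.1 (b P).2.2
  choose G h1 h2 h3 h4 using key
  have hsame : ∀ P, rationalJets K d (G P) P = b P := fun P =>
    Prod.ext (h1 P) (Prod.ext (h2 P) (h3 P))
  have hother : ∀ P P', P ≠ P' → rationalJets K d (G P) P' = 0 := by
    intro P P' hne
    rw [rationalJets_eq_zero_iff]
    refine h4 P K P'.rep ⟨1, Finset.mem_Icc.mpr ⟨le_rfl, hr⟩, fun l => ?_⟩ fun c hc => hne ?_
    · have := Fintype.ofFinite K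
      rw [pow_one, Nat.card_eq_fintype_card, FiniteField.pow_card]
    · rw [← P.mk_rep, ← P'.mk_rep, eq_comm, Projectivization.mk_eq_mk_iff']
      exact ⟨c, hc.symm⟩
  refine ⟨∑ P, G P, ?_, fun F hF v hv hv1 hvr hs => ?_⟩
  · rw [map_sum]
    funext P
    rw [Finset.sum_apply, Finset.sum_eq_single P (fun P' _ hne => hother P' P hne) (by simp),
      hsame]
  · refine hF v hv hv1 hvr ?_
    have hh : SingularAt ((∑ P, G P : Forms K d) : MvPolynomial (Fin 3) K) v := by
      rw [Submodule.coe_sum]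
      refine singularAt_sum _ _ fun P _ => h4 P _ v ⟨coordDegree K v,
        Finset.mem_Icc.mpr ⟨hv1.le, hvr⟩, pow_card_coordDegree v⟩ fun c hc => ?_
      obtain ⟨i, hi⟩ := hv.exists_eq_one
      -- A coordinate equal to `1` forces the factor `c` into `K`, so `v` would be rational, against
      -- its degree exceeding `1`.
      have hci : c * algebraMap K _ (P.rep i) = 1 := by
        rw [← hi]; exact (congrFun hc i).symm
      have hc' : c = algebraMap K _ (P.rep i)⁻¹ := by
        rw [map_inv₀]; exact eq_inv_of_mul_eq_one_left hci
      have : v = fun l => algebraMap K (AlgebraicClosure K) ((P.rep i)⁻¹ * P.rep l) := by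
        rw [hc, hc']; ext l; simp
      rw [this, coordDegree_algebraMap] at hv1
      omega
    have := hs.add hh.neg
    rwa [Submodule.coe_add, add_neg_cancel_right] at this

theorem mul_ncard_nonsingularForms {d r : ℕ} (hr : 1 ≤ r) (hd : 8 * Nat.card K ^ r + 3 ≤ d)
    (S : Set (ℙ K (Fin 3 → K) → K × K × K)) :
    {F | F ∈ nonsingularForms K d r ∧ rationalJets K d F ∈ S}.ncard *
      Nat.card (ℙ K (Fin 3 → K) → K × K × K) = (nonsingularForms K d r).ncard * S.ncard :=
  have := finite_forms (K := K) d
  ncard_mul_card_of_translation_invariant _ _ (exists_translation hr hd) S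

/-- The density of forms smooth at all nonrational points with given jets at rational points. -/
theorem ncard_smooth_with_jets_bounds {d r : ℕ} (hr : 1 ≤ r) (hd : 8 * Nat.card K ^ r + 3 ≤ d)
    (S : Set (ℙ K (Fin 3 → K) → K × K × K)) :
    ({F | F ∉ singularForms K d 1 ∧ rationalJets K d F ∈ S}.ncard : ℝ) ≤
      (nonsingularForms K d r).ncard * S.ncard / Nat.card (ℙ K (Fin 3 → K) → K × K × K) ∧
    (nonsingularForms K d r).ncard * S.ncard / Nat.card (ℙ K (Fin 3 → K) → K × K × K) -
      (2 / (Nat.card K : ℝ) ^ r + highDegreeBound (Nat.card K) d) * Nat.card (Forms K d) ≤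
      ({F | F ∉ singularForms K d 1 ∧ rationalJets K d F ∈ S}.ncard : ℝ) := by
  have := finite_forms (K := K) d
  have hpos : (0 : ℝ) < Nat.card (ℙ K (Fin 3 → K) → K × K × K) := by
    exact_mod_cast Nat.card_pos
  have h1 : ((nonsingularForms K d r).ncard * S.ncard : ℝ) /
      Nat.card (ℙ K (Fin 3 → K) → K × K × K) =
      ({F | F ∈ nonsingularForms K d r ∧ rationalJets K d F ∈ S}.ncard : ℝ) := by
    rw [div_eq_iff hpos.ne']
    exact_mod_cast (mul_ncard_nonsingularForms hr hd S).symm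
  rw [h1]
  constructor
  · have : {F | F ∉ singularForms K d 1 ∧ rationalJets K d F ∈ S} ⊆
        {F | F ∈ nonsingularForms K d r ∧ rationalJets K d F ∈ S} :=
      fun F hF => ⟨fun v hv hv1 _ hs => hF.1 ⟨v, hv, hv1, hs⟩, hF.2⟩
    exact_mod_cast Set.ncard_le_ncard this (Set.toFinite _)
  -- A form in `U` singular at a nonrational point is singular at one of degree above `r`; those
  -- forms make up the error.
  · have h2 : {F | F ∈ nonsingularForms K d r ∧ rationalJets K d F ∈ S} ⊆
        {F | F ∉ singularForms K d 1 ∧ rationalJets K d F ∈ S} ∪ singularForms K d r := by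
      intro F hF
      by_cases h : F ∈ singularForms K d r
      · exact Or.inr h
      · refine Or.inl ⟨?_, hF.2⟩
        rintro ⟨v, hv, hv1, hs⟩
        by_cases hvr : coordDegree K v ≤ r
        · exact hF.1 v hv hv1 hvr hs
        · exact h ⟨v, hv, by omega, hs⟩
    have h3 : ({F | F ∈ nonsingularForms K d r ∧ rationalJets K d F ∈ S}.ncard : ℝ) ≤
        ({F | F ∉ singularForms K d 1 ∧ rationalJets K d F ∈ S}.ncard : ℝ) +
          ((singularForms K d r).ncard : ℝ) := by
      exact_mod_cast (Set.ncard_le_ncard h2 (Set.toFinite _)).trans (Set.ncard_union_le _ _)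
    have h4 := ncard_singularForms_le (K := K) (d := d) (by omega) hr
    have hq : (1 : ℝ) ≤ (Nat.card K : ℝ) ^ r :=
      one_le_pow₀ (by exact_mod_cast (Finite.one_lt_card (α := K)).le)
    have h5 : (((Nat.card K : ℝ) ^ r)⁻¹) ^ 2 ≤ ((Nat.card K : ℝ) ^ r)⁻¹ := by
      have h0 : ((Nat.card K : ℝ) ^ r)⁻¹ ≤ 1 := inv_le_one_of_one_le₀ hq
      have : 0 ≤ ((Nat.card K : ℝ) ^ r)⁻¹ := by positivity
      nlinarith
    have h6 : (((Nat.card K : ℝ) ^ r)⁻¹ + (((Nat.card K : ℝ) ^ r)⁻¹) ^ 2 / 3 +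
        highDegreeBound (Nat.card K) d) * Nat.card (Forms K d) ≤
        (2 / (Nat.card K : ℝ) ^ r + highDegreeBound (Nat.card K) d) * Nat.card (Forms K d) := by
      refine mul_le_mul_of_nonneg_right ?_ (by positivity)
      rw [div_eq_mul_inv (2 : ℝ)]
      have : 0 ≤ ((Nat.card K : ℝ) ^ r)⁻¹ := by positivity
      linarith
    linarith

/-- For `q ≥ 2` the nonrational points exclude density at most `1/2 + 1/12 = 7/12`, apart from the
high-degree term. This replaces any evaluation of an Euler product. -/
theorem ncard_nonsingularForms_ge {d : ℕ} (hd : 1 ≤ d) (r : ℕ) :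
    (5 / 12 - highDegreeBound (Nat.card K) d) * Nat.card (Forms K d) ≤
      ((nonsingularForms K d r).ncard : ℝ) := by
  have := finite_forms (K := K) d
  have h1 : (Set.univ : Set (Forms K d)) ⊆ nonsingularForms K d r ∪ singularForms K d 1 := by
    intro F _
    by_cases h : F ∈ singularForms K d 1
    · exact Or.inr h
    · exact Or.inl fun v hv hv1 _ hs => h ⟨v, hv, hv1, hs⟩
  have h2 : (Nat.card (Forms K d) : ℝ) ≤
      ((nonsingularForms K d r).ncard : ℝ) + ((singularForms K d 1).ncard : ℝ) := by
    rw [← Set.ncard_univ]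
    exact_mod_cast (Set.ncard_le_ncard h1 (Set.toFinite _)).trans (Set.ncard_union_le _ _)
  have h3 := ncard_singularForms_le (K := K) hd le_rfl
  have hq : (2 : ℝ) ≤ Nat.card K := by exact_mod_cast (Finite.one_lt_card (α := K))
  have h4 : ((Nat.card K : ℝ) ^ 1)⁻¹ ≤ 2⁻¹ := by
    rw [pow_one]; exact inv_anti₀ (by norm_num) hq
  have h5 : 0 ≤ ((Nat.card K : ℝ) ^ 1)⁻¹ := by positivity
  have h6 : (((Nat.card K : ℝ) ^ 1)⁻¹ + (((Nat.card K : ℝ) ^ 1)⁻¹) ^ 2 / 3 +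
      highDegreeBound (Nat.card K) d) * Nat.card (Forms K d) ≤
      (7 / 12 + highDegreeBound (Nat.card K) d) * Nat.card (Forms K d) := by
    refine mul_le_mul_of_nonneg_right ?_ (by positivity)
    nlinarith
  linarith

end Main

/-! ### Binomial counts and the binomial law -/

section Binomial

/-- Functions are sorted by the `t`-element set of places where they land in `A`. -/
theorem card_functions_with_count {R X : Type*} [Fintype R] [DecidableEq R] [DecidableEq X]
    (A B : Finset X) (hAB : Disjoint A B) (t : ℕ) :
    {b : R → X | (∀ P, b P ∈ A ∪ B) ∧ {P | b P ∈ A}.ncard = t}.ncard =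
      (Fintype.card R).choose t * (A.card ^ t * B.card ^ (Fintype.card R - t)) := by
  classical
  have h0 : {b : R → X | (∀ P, b P ∈ A ∪ B) ∧ {P | b P ∈ A}.ncard = t} =
      (((Finset.univ : Finset R).powersetCard t).biUnion fun T =>
        Fintype.piFinset fun P => if P ∈ T then A else B : Finset (R → X)) := by
    ext b
    simp only [Set.mem_ofPred_eq, Finset.coe_biUnion, Finset.mem_coe, Finset.mem_powersetCard,
      Finset.subset_univ, true_and, Set.mem_iUnion, Fintype.mem_piFinset, exists_prop]
    constructor
    · rintro ⟨h1, h2⟩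
      refine ⟨Finset.univ.filter fun P => b P ∈ A, ?_, fun P => ?_⟩
      · rw [← h2, ← Set.ncard_coe_finset]; simp
      · by_cases hP : b P ∈ A
        · simp [hP]
        · have := (Finset.mem_union.mp (h1 P)).resolve_left hP
          simpa [hP] using this
    · rintro ⟨T, hT, h⟩
      have hmem : ∀ P, b P ∈ A ↔ P ∈ T := fun P => by
        have := h P
        by_cases hP : P ∈ T
        · simpa [hP] using this
        · rw [if_neg hP] at this
          exact iff_of_false (fun h' => Finset.disjoint_left.mp hAB h' this) hP
      refine ⟨fun P => ?_, ?_⟩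
      · have := h P
        split_ifs at this
        · exact Finset.mem_union_left _ this
        · exact Finset.mem_union_right _ this
      · simp only [hmem]
        rw [← hT, ← Set.ncard_coe_finset]; rfl
  rw [h0, Set.ncard_coe_finset, Finset.card_biUnion]
  · rw [Finset.sum_congr rfl (g := fun _ => A.card ^ t * B.card ^ (Fintype.card R - t)),
      Finset.sum_const, Finset.card_powersetCard, Finset.card_univ, smul_eq_mul]
    intro T hT
    have hT' := (Finset.mem_powersetCard.mp hT).2
    rw [Fintype.card_piFinset]
    simp only [apply_ite Finset.card]
    rw [Finset.prod_ite]
    simp only [Finset.prod_const, Finset.filter_mem_eq_inter, Finset.univ_inter, hT',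
      Finset.filter_not, Finset.card_univ_sdiff]
  · intro T _ T' _ hne
    rw [Function.onFun, Finset.disjoint_left]
    intro b hb hb'
    rw [Fintype.mem_piFinset] at hb hb'
    refine hne (Finset.ext fun P => ?_)
    have h1 := hb P
    have h2 := hb' P
    by_cases hP : P ∈ T <;> by_cases hP' : P ∈ T' <;>
      simp only [hP, hP', if_true, if_false] at h1 h2 ⊢
    · exact (Finset.disjoint_left.mp hAB h1 h2).elim
    · exact (Finset.disjoint_left.mp hAB h2 h1).elim

/-- The variables are `0` or `1` only almost surely, because `a + b = 1`. Up to a null set the event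
is then the disjoint union, over `t`-subsets, of events whose measure independence computes. -/
theorem real_sum_eq_binomial {Ω : Type v} [MeasurableSpace Ω] (μ : Measure Ω)
    [IsProbabilityMeasure μ] {n : ℕ} {X : Fin n → Ω → ℝ} (hX : ∀ i, Measurable (X i))
    (hind : iIndepFun X μ) {a b : ℝ} (ha : ∀ i, μ.real {ω | X i ω = 1} = a)
    (hb : ∀ i, μ.real {ω | X i ω = 0} = b) (hab : a + b = 1) (t : ℕ) :
    μ.real {ω | ∑ i, X i ω = (t : ℝ)} = n.choose t * (a ^ t * b ^ (n - t)) := by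
  classical
  have hae : ∀ᵐ ω ∂μ, ∀ i, X i ω = 1 ∨ X i ω = 0 := by
    rw [ae_all_iff]
    intro i
    have hm1 : MeasurableSet {ω | X i ω = 1} := hX i (measurableSet_singleton 1)
    have hm0 : MeasurableSet {ω | X i ω = 0} := hX i (measurableSet_singleton 0)
    have hd : Disjoint {ω | X i ω = 1} {ω | X i ω = 0} :=
      Set.disjoint_left.mpr fun ω h1 h0 => by
        have h1' : X i ω = 1 := h1
        have h0' : X i ω = 0 := h0
        rw [h1'] at h0'; exact one_ne_zero h0'
    have h : μ.real ({ω | X i ω = 1} ∪ {ω | X i ω = 0}) = 1 := by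
      rw [measureReal_union hd hm0, ha, hb, hab]
    have h' : μ ({ω | X i ω = 1} ∪ {ω | X i ω = 0}) = 1 := by
      rw [measureReal_def] at h
      rw [← ENNReal.toReal_eq_one_iff]; exact h
    exact (mem_ae_iff_prob_eq_one (hm1.union hm0)).mpr h'
  let E : Finset (Fin n) → Set Ω := fun T => ⋂ i, X i ⁻¹' {if i ∈ T then (1 : ℝ) else 0}
  have hE : ∀ T, MeasurableSet (E T) := fun T =>
    MeasurableSet.iInter fun i => hX i (measurableSet_singleton _)
  have hEm : ∀ T, ∀ ω ∈ E T, ∀ i, (X i ω = 1 ↔ i ∈ T) := by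
    intro T ω hω i
    have h1 : X i ω = if i ∈ T then 1 else 0 := Set.mem_iInter.mp hω i
    rw [h1]; split_ifs with h <;> simp [h]
  have heq : {ω | ∑ i, X i ω = (t : ℝ)} =ᵐ[μ]
      ⋃ T ∈ (Finset.univ : Finset (Fin n)).powersetCard t, E T := by
    filter_upwards [hae] with ω hω
    refine propext ?_
    change ∑ i, X i ω = (t : ℝ) ↔ ω ∈ ⋃ T ∈ (Finset.univ : Finset (Fin n)).powersetCard t, E T
    have hval : ∀ i, X i ω = if X i ω = 1 then 1 else 0 := by
      intro i
      rcases hω i with h | h <;> simp [h]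
    have hs : ∑ i, X i ω = ((Finset.univ.filter fun i => X i ω = 1).card : ℝ) := by
      rw [Finset.sum_congr rfl fun i _ => hval i, Finset.sum_boole]
    rw [hs, Nat.cast_inj]
    simp only [Set.mem_iUnion, Finset.mem_powersetCard, Finset.subset_univ, true_and, exists_prop]
    constructor
    · intro h
      refine ⟨_, h, Set.mem_iInter.mpr fun i => ?_⟩
      simpa using hval i
    · rintro ⟨T, rfl, hT⟩
      congr 1
      ext i
      simpa using hEm T ω hT i
  rw [measureReal_congr heq, measureReal_biUnion_finset]
  · rw [Finset.sum_congr rfl (g := fun _ => a ^ t * b ^ (n - t)), Finset.sum_const,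
      Finset.card_powersetCard, Finset.card_univ, Fintype.card_fin, nsmul_eq_mul]
    intro T hT
    have hT' := (Finset.mem_powersetCard.mp hT).2
    have h1 := hind.measure_inter_preimage_eq_mul Finset.univ
      (sets := fun i => {if i ∈ T then (1 : ℝ) else 0}) (fun i _ => measurableSet_singleton _)
    simp only [Finset.mem_univ, Set.iInter_true] at h1
    rw [measureReal_def, h1, ENNReal.toReal_prod]
    have h2 : ∀ i, (μ (X i ⁻¹' {if i ∈ T then (1 : ℝ) else 0})).toReal = if i ∈ T then a else b := by
      intro i
      split_ifs
      · exact ha i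
      · exact hb i
    rw [Finset.prod_congr rfl fun i _ => h2 i, Finset.prod_ite]
    simp only [Finset.prod_const, Finset.filter_mem_eq_inter, Finset.univ_inter, hT',
      Finset.filter_not, Finset.card_univ_sdiff, Fintype.card_fin]
  · intro T _ T' _ hne
    rw [Function.onFun, Set.disjoint_left]
    intro ω h h'
    exact hne (Finset.ext fun i => (hEm T ω h i).symm.trans (hEm T' ω h' i))
  · exact fun T _ => hE T

end Binomial

/-! ### Existence of smooth curves -/

section SmoothCurves

/-- Smooth plane curves exist in every degree: the Fermat curve if `p ∤ d`, and the curve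
`x ^ (d - 1) * y + y ^ d + z ^ (d - 1) * x` if `p ∣ d`. -/
theorem smoothForms_nonempty (K : Type u) [Field K] [Finite K] {d : ℕ} (hd : 1 ≤ d) :
    (smoothForms K d).Nonempty := by
  have hX : ∀ (i : Fin 3) (n : ℕ), (X i ^ n : MvPolynomial (Fin 3) K).IsHomogeneous n :=
    fun i n => by simpa using (isHomogeneous_X K i).pow n
  have hzero : ∀ x : Fin 3 → AlgebraicClosure K, x 0 = 0 → x 1 = 0 → x 2 = 0 → x = 0 :=
    fun x h0 h1 h2 => funext fun l => by fin_cases l <;> assumption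
  by_cases hdK : (d : K) = 0
  · have hd2 : 2 ≤ d := by
      by_contra h
      have : d = 1 := by omega
      subst this
      simp at hdK
    have h1 : d - 1 + 1 = d := by omega
    refine ⟨X 0 ^ (d - 1) * X 1 + X 1 ^ d + X 2 ^ (d - 1) * X 0, ?_, ?_⟩
    · have e1 := (hX 0 (d - 1)).mul (isHomogeneous_X K 1)
      have e2 := (hX 2 (d - 1)).mul (isHomogeneous_X K 0)
      rw [h1] at e1 e2
      exact (e1.add (hX 1 d)).add e2
    · rintro x hx ⟨hF, hF'⟩
      have hdL : (d : AlgebraicClosure K) = 0 := by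
        have := congrArg (algebraMap K (AlgebraicClosure K)) hdK
        simpa using this
      have p0 := hF' 0
      have p1 := hF' 1
      simp [Derivation.leibniz, Derivation.leibniz_pow, hdL] at p0 p1
      -- As `d = 0` in `K`, the second partial is `x ^ (d - 1)`; then the equation leaves `y ^ d`,
      -- and finally the first partial leaves `z ^ (d - 1)`.
      have x0 : x 0 = 0 := p1.1
      have hd0 : d - 1 ≠ 0 := by omega
      have x1 : x 1 = 0 := by
        simpa [x0, hd0, show d ≠ 0 by omega] using hF
      refine hx (hzero x x0 x1 ?_)
      simpa [x0, x1, hd0] using p0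
  · refine ⟨X 0 ^ d + X 1 ^ d + X 2 ^ d, ((hX 0 d).add (hX 1 d)).add (hX 2 d), ?_⟩
    rintro x hx ⟨-, hF'⟩
    have hdL : (d : AlgebraicClosure K) ≠ 0 := by
      have := (map_ne_zero (algebraMap K (AlgebraicClosure K))).mpr hdK
      simpa using this
    have p0 := hF' 0
    have p1 := hF' 1
    have p2 := hF' 2
    simp [Derivation.leibniz_pow, hdL] at p0 p1 p2
    exact hx (hzero x p0.1 p1.1 p2.1)

end SmoothCurves

/-! ### Counting jets -/

noncomputable section

/-- The binomial probability of `t` successes among `q ^ 2 + q + 1` trials. -/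
def pointCountProb (q t : ℕ) : ℝ :=
  (q ^ 2 + q + 1).choose t * ((((q : ℝ) + 1) / ((q : ℝ) ^ 2 + q + 1)) ^ t *
    ((q : ℝ) ^ 2 / ((q : ℝ) ^ 2 + q + 1)) ^ (q ^ 2 + q + 1 - t))

/-- The density of forms smooth at all rational points. -/
def rationalSmoothDensity (q : ℕ) : ℝ :=
  (((q : ℝ) ^ 3 - 1) / (q : ℝ) ^ 3) ^ (q ^ 2 + q + 1)

end

section Count

variable (K : Type u) [Field K] [Finite K]

theorem card_rationalPlane :
    Nat.card (ℙ K (Fin 3 → K)) = Nat.card K ^ 2 + Nat.card K + 1 := by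
  rw [Projectivization.card_of_finrank K (Fin 3 → K) (Module.finrank_fin_fun K)]
  simp [Finset.sum_range_succ]; ring

theorem ncard_nonzero_jets :
    ({b : ℙ K (Fin 3 → K) → K × K × K | ∀ P, b P ≠ 0}.ncard : ℝ) =
      ((Nat.card K : ℝ) ^ 3 - 1) ^ (Nat.card K ^ 2 + Nat.card K + 1) := by
  classical
  have := Fintype.ofFinite K
  have := Fintype.ofFinite (ℙ K (Fin 3 → K))
  have h : {b : ℙ K (Fin 3 → K) → K × K × K | ∀ P, b P ≠ 0} =
      (Fintype.piFinset fun _ => Finset.univ.erase 0 : Finset (ℙ K (Fin 3 → K) → K × K × K)) := by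
    ext b; simp
  rw [h, Set.ncard_coe_finset, Fintype.card_piFinset, Finset.prod_const, Finset.card_univ,
    ← Nat.card_eq_fintype_card, card_rationalPlane, Finset.card_erase_of_mem (Finset.mem_univ _),
    Finset.card_univ, Fintype.card_prod, Fintype.card_prod, ← Nat.card_eq_fintype_card]
  have h1 : 1 ≤ Nat.card K * (Nat.card K * Nat.card K) := by
    have : 0 < Nat.card K := Nat.card_pos
    exact Nat.mul_pos this (Nat.mul_pos this this)
  push_cast [Nat.cast_sub h1]
  ring

theorem ncard_nonzero_jets_with_count (t : ℕ) :
    ({b : ℙ K (Fin 3 → K) → K × K × K |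
      (∀ P, b P ≠ 0) ∧ {P | (b P).1 = 0}.ncard = t}.ncard : ℝ) =
      (Nat.card K ^ 2 + Nat.card K + 1).choose t * (((Nat.card K : ℝ) ^ 2 - 1) ^ t *
        ((Nat.card K : ℝ) ^ 3 - (Nat.card K : ℝ) ^ 2) ^ (Nat.card K ^ 2 + Nat.card K + 1 - t)) := by
  classical
  have := Fintype.ofFinite K
  have := Fintype.ofFinite (ℙ K (Fin 3 → K))
  let A : Finset (K × K × K) := (({0} : Finset K) ×ˢ Finset.univ).erase 0
  let B : Finset (K × K × K) := (Finset.univ.erase (0 : K)) ×ˢ Finset.univ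
  have hA : ∀ x, x ∈ A ↔ x ≠ 0 ∧ x.1 = 0 := fun x => by
    rw [Finset.mem_erase, Finset.mem_product]; simp
  have hB : ∀ x, x ∈ B ↔ x.1 ≠ 0 := fun x => by simp [B]
  have hAB : Disjoint A B := Finset.disjoint_left.mpr fun x h1 h2 =>
    (hB x).mp h2 ((hA x).mp h1).2
  have h := card_functions_with_count (R := ℙ K (Fin 3 → K)) A B hAB t
  have hset : {b : ℙ K (Fin 3 → K) → K × K × K |
      (∀ P, b P ≠ 0) ∧ {P | (b P).1 = 0}.ncard = t} =
      {b | (∀ P, b P ∈ A ∪ B) ∧ {P | b P ∈ A}.ncard = t} := by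
    ext b
    have h1 : ∀ P, b P ∈ A ∪ B ↔ b P ≠ 0 := fun P => by
      rw [Finset.mem_union, hA, hB]
      by_cases h : b P = 0
      · simp [h]
      · by_cases h' : (b P).1 = 0 <;> simp [h, h']
    simp only [Set.mem_ofPred_eq, h1]
    refine and_congr_right fun h2 => ?_
    simp only [hA, h2, ne_eq, not_false_eq_true, true_and]
  have hAc : A.card = Nat.card K ^ 2 - 1 := by
    rw [Finset.card_erase_of_mem (by simp), Finset.card_product, Finset.card_univ,
      Fintype.card_prod, ← Nat.card_eq_fintype_card]
    simp [sq]
  have hBc : B.card = (Nat.card K - 1) * (Nat.card K * Nat.card K) := by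
    rw [Finset.card_product, Finset.card_univ, Fintype.card_prod,
      Finset.card_erase_of_mem (Finset.mem_univ _), Finset.card_univ, ← Nat.card_eq_fintype_card]
  have hq : 1 ≤ Nat.card K := Nat.card_pos
  have hq2 : 1 ≤ Nat.card K ^ 2 := Nat.one_le_pow _ _ hq
  rw [hset, h, hAc, hBc, ← Nat.card_eq_fintype_card, card_rationalPlane]
  push_cast [Nat.cast_sub hq, Nat.cast_sub hq2]
  ring

/-- The success probability arises here: `q ^ 2 - 1` and `q ^ 3 - q ^ 2` divided by `q ^ 3 - 1` are
`(q + 1) / (q ^ 2 + q + 1)` and `q ^ 2 / (q ^ 2 + q + 1)`. -/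
theorem ncard_jets_ratio (t : ℕ) :
    ({b : ℙ K (Fin 3 → K) → K × K × K |
      (∀ P, b P ≠ 0) ∧ {P | (b P).1 = 0}.ncard = t}.ncard : ℝ) =
      pointCountProb (Nat.card K) t *
        ({b : ℙ K (Fin 3 → K) → K × K × K | ∀ P, b P ≠ 0}.ncard : ℝ) := by
  rw [ncard_nonzero_jets, ncard_nonzero_jets_with_count, pointCountProb]
  set q := Nat.card K
  rcases lt_or_ge (q ^ 2 + q + 1) t with h | h
  · simp [Nat.choose_eq_zero_of_lt h]
  · have hn : (0 : ℝ) < (q : ℝ) ^ 2 + q + 1 := by positivity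
    have e1 : (q : ℝ) ^ 2 - 1 = ((q : ℝ) + 1) / ((q : ℝ) ^ 2 + q + 1) * ((q : ℝ) ^ 3 - 1) := by
      field_simp; ring
    have e2 : (q : ℝ) ^ 3 - (q : ℝ) ^ 2 =
        (q : ℝ) ^ 2 / ((q : ℝ) ^ 2 + q + 1) * ((q : ℝ) ^ 3 - 1) := by
      field_simp; ring
    have e3 : ((q : ℝ) ^ 3 - 1) ^ (q ^ 2 + q + 1) =
        ((q : ℝ) ^ 3 - 1) ^ t * ((q : ℝ) ^ 3 - 1) ^ (q ^ 2 + q + 1 - t) := by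
      rw [← pow_add, Nat.add_sub_cancel' h]
    rw [e1, e2, mul_pow, mul_pow, e3]
    ring

theorem ncard_nonzero_jets_div :
    ({b : ℙ K (Fin 3 → K) → K × K × K | ∀ P, b P ≠ 0}.ncard : ℝ) /
      Nat.card (ℙ K (Fin 3 → K) → K × K × K) = rationalSmoothDensity (Nat.card K) := by
  have := Fintype.ofFinite K
  have := Fintype.ofFinite (ℙ K (Fin 3 → K))
  rw [ncard_nonzero_jets, rationalSmoothDensity, Nat.card_fun, card_rationalPlane,
    Nat.card_prod, Nat.card_prod, div_pow]
  push_cast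
  congr 2
  ring

end Count

/-! ### The proportion of smooth curves with `t` points -/

section Proportion

theorem pointCountProb_nonneg (q t : ℕ) : 0 ≤ pointCountProb q t := by
  unfold pointCountProb; positivity

/-- A crude bound, but positive and uniform in `t`; it converts absolute into relative errors. -/
theorem pointCountProb_ge {q t : ℕ} (ht : t ≤ q ^ 2 + q + 1) :
    ((((q : ℝ) + 1) / ((q : ℝ) ^ 2 + q + 1)) * ((q : ℝ) ^ 2 / ((q : ℝ) ^ 2 + q + 1))) ^
      (q ^ 2 + q + 1) ≤ pointCountProb q t := by
  have hn : (0 : ℝ) < (q : ℝ) ^ 2 + q + 1 := by positivity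
  have hq0 : (0 : ℝ) ≤ q := by positivity
  have ha : ((q : ℝ) + 1) / ((q : ℝ) ^ 2 + q + 1) ≤ 1 := by
    rw [div_le_one hn]; nlinarith
  have hb : (q : ℝ) ^ 2 / ((q : ℝ) ^ 2 + q + 1) ≤ 1 := by
    rw [div_le_one hn]; linarith
  have hc : (1 : ℝ) ≤ (q ^ 2 + q + 1).choose t := by
    exact_mod_cast Nat.choose_pos ht
  rw [mul_pow, pointCountProb]
  have h1 := pow_le_pow_of_le_one (by positivity) ha ht
  have h2 := pow_le_pow_of_le_one (by positivity) hb (Nat.sub_le (q ^ 2 + q + 1) t)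
  have h3 := mul_le_mul h1 h2 (by positivity) (by positivity)
  exact h3.trans (le_mul_of_one_le_left (by positivity) hc)

theorem pointCountProb_le_one (K : Type u) [Field K] [Finite K] (t : ℕ) :
    pointCountProb (Nat.card K) t ≤ 1 := by
  have h := ncard_jets_ratio K t
  have hpos : (0 : ℝ) < {b : ℙ K (Fin 3 → K) → K × K × K | ∀ P, b P ≠ 0}.ncard := by
    rw [ncard_nonzero_jets]
    have hq : (2 : ℝ) ≤ Nat.card K := by exact_mod_cast (Finite.one_lt_card (α := K))
    have : (1 : ℝ) < (Nat.card K : ℝ) ^ 3 := one_lt_pow₀ (by linarith) (by norm_num)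
    have : 0 < (Nat.card K : ℝ) ^ 3 - 1 := by linarith
    positivity
  have h2 : ({b : ℙ K (Fin 3 → K) → K × K × K |
      (∀ P, b P ≠ 0) ∧ {P | (b P).1 = 0}.ncard = t}.ncard : ℝ) ≤
      {b : ℙ K (Fin 3 → K) → K × K × K | ∀ P, b P ≠ 0}.ncard := by
    have hsub : {b : ℙ K (Fin 3 → K) → K × K × K |
        (∀ P, b P ≠ 0) ∧ {P | (b P).1 = 0}.ncard = t} ⊆ {b | ∀ P, b P ≠ 0} := fun b hb => hb.1
    exact_mod_cast Set.ncard_le_ncard hsub (Set.toFinite _)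
  rw [h] at h2
  exact le_of_mul_le_mul_right (by linarith) hpos

variable (K : Type u) [Field K] [Finite K]

theorem ncard_smoothForms_eq (d : ℕ) :
    (smoothForms K d).ncard = {F : Forms K d | F ∉ singularForms K d 1 ∧
      rationalJets K d F ∈ {b | ∀ P, b P ≠ 0}}.ncard := by
  have : smoothForms K d = Subtype.val '' {F : Forms K d | F ∉ singularForms K d 1 ∧
      rationalJets K d F ∈ {b | ∀ P, b P ≠ 0}} := by
    ext F
    constructor
    · rintro ⟨h1, h2⟩
      exact ⟨⟨F, h1⟩, (definesSmoothPlaneCurve_iff ⟨F, h1⟩).mp h2, rfl⟩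
    · rintro ⟨F, hF, rfl⟩
      exact ⟨F.2, (definesSmoothPlaneCurve_iff F).mpr hF⟩
  rw [this, Set.ncard_image_of_injective _ Subtype.val_injective]

theorem ncard_smoothForms_with_count_eq (d t : ℕ) :
    {F ∈ smoothForms K d | (rationalPoints F).ncard = t}.ncard =
      {F : Forms K d | F ∉ singularForms K d 1 ∧
        rationalJets K d F ∈ {b | (∀ P, b P ≠ 0) ∧ {P | (b P).1 = 0}.ncard = t}}.ncard := by
  have hr : ∀ F : Forms K d, rationalPoints (F : MvPolynomial (Fin 3) K) =
      {P | (rationalJets K d F P).1 = 0} := fun F =>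
    Set.ext fun P => mem_rationalPoints_iff F P
  have : {F ∈ smoothForms K d | (rationalPoints F).ncard = t} =
      Subtype.val '' {F : Forms K d | F ∉ singularForms K d 1 ∧
        rationalJets K d F ∈ {b | (∀ P, b P ≠ 0) ∧ {P | (b P).1 = 0}.ncard = t}} := by
    ext F
    constructor
    · rintro ⟨⟨h1, h2⟩, h3⟩
      have h4 := (definesSmoothPlaneCurve_iff ⟨F, h1⟩).mp h2
      exact ⟨⟨F, h1⟩, ⟨h4.1, h4.2, by rw [← hr]; exact h3⟩, rfl⟩
    · rintro ⟨F, ⟨h1, h2, h3⟩, rfl⟩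
      exact ⟨⟨F.2, (definesSmoothPlaneCurve_iff F).mpr ⟨h1, h2⟩⟩, by rw [hr]; exact h3⟩
  rw [this, Set.ncard_image_of_injective _ Subtype.val_injective]

theorem highDegreeBound_nonneg (q d : ℕ) : 0 ≤ highDegreeBound q d := by
  unfold highDegreeBound; positivity

theorem rationalSmoothDensity_pos {q : ℕ} (hq : 2 ≤ q) : 0 < rationalSmoothDensity q := by
  have hq : (2 : ℝ) ≤ q := by exact_mod_cast hq
  have : (1 : ℝ) < (q : ℝ) ^ 3 := one_lt_pow₀ (by linarith) (by norm_num)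
  have : 0 < (q : ℝ) ^ 3 - 1 := by linarith
  unfold rationalSmoothDensity
  positivity

/-- Numerator and denominator are estimated through the same `U`, as `π * U * β` and `U * β` up to
`ε * T`, so `U` cancels in `M - π * N`. The bound `ε ≤ 1 / 6` gives `U ≥ T / 4`, as `5/12 - 1/6 =
1/4`, and `ε ≤ β / 8` then gives `N ≥ β / 8 * T`. -/
theorem abs_smoothProportion_sub_le {d r : ℕ} (hr : 1 ≤ r) (hd : 8 * Nat.card K ^ r + 3 ≤ d)
    {ε : ℝ} (hε : 2 / (Nat.card K : ℝ) ^ r + highDegreeBound (Nat.card K) d ≤ ε) (h6 : ε ≤ 1 / 6)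
    (h8 : ε ≤ rationalSmoothDensity (Nat.card K) / 8) (t : ℕ) :
    |smoothProportion K d t - pointCountProb (Nat.card K) t| ≤
      8 * ε / rationalSmoothDensity (Nat.card K) := by
  have := finite_forms (K := K) d
  set q := Nat.card K with hq
  set β := rationalSmoothDensity q with hβ
  set π := pointCountProb q t with hπ
  have hβ0 : 0 < β := rationalSmoothDensity_pos Finite.one_lt_card
  have hπ0 : 0 ≤ π := pointCountProb_nonneg q t
  have hπ1 : π ≤ 1 := pointCountProb_le_one K t
  set T : ℝ := (Nat.card (Forms K d) : ℝ) with hT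
  have hT0 : 0 < T := by rw [hT]; exact_mod_cast Nat.card_pos
  have hh : highDegreeBound q d ≤ ε := by
    have : 0 ≤ 2 / (q : ℝ) ^ r := by positivity
    linarith
  have hU := ncard_nonsingularForms_ge (K := K) (d := d) (by omega) r
  set U : ℝ := ((nonsingularForms K d r).ncard : ℝ) with hUdef
  have hU4 : 1 / 4 * T ≤ U := by
    refine le_trans (mul_le_mul_of_nonneg_right ?_ hT0.le) hU
    linarith
  obtain ⟨n1, n2⟩ := ncard_smooth_with_jets_bounds hr hd {b | ∀ P, b P ≠ 0}
  obtain ⟨m1, m2⟩ := ncard_smooth_with_jets_bounds hr hd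
    {b | (∀ P, b P ≠ 0) ∧ {P | (b P).1 = 0}.ncard = t}
  rw [← ncard_smoothForms_eq, mul_div_assoc, ncard_nonzero_jets_div] at n1 n2
  rw [← ncard_smoothForms_with_count_eq, ncard_jets_ratio, mul_div_assoc, mul_div_assoc,
    ncard_nonzero_jets_div] at m1 m2
  rw [smoothProportion]
  set N : ℝ := ((smoothForms K d).ncard : ℝ) with hN
  set M : ℝ := ({F ∈ smoothForms K d | (rationalPoints F).ncard = t}.ncard : ℝ) with hM
  have hεT : (2 / (q : ℝ) ^ r + highDegreeBound q d) * T ≤ ε * T :=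
    mul_le_mul_of_nonneg_right hε hT0.le
  have hε0 : 0 ≤ ε := (highDegreeBound_nonneg q d).trans hh
  have hN8 : β / 8 * T ≤ N := by
    have h1 : 1 / 4 * T * β ≤ U * β := mul_le_mul_of_nonneg_right hU4 hβ0.le
    have h2 : ε * T ≤ β / 8 * T := mul_le_mul_of_nonneg_right h8 hT0.le
    linarith
  have hN0 : 0 < N := lt_of_lt_of_le (by positivity) hN8
  have hdiff : |M - π * N| ≤ ε * T := by
    have h1 : π * N ≤ π * (U * β) := mul_le_mul_of_nonneg_left n1 hπ0
    have h2 : π * (U * β - ε * T) ≤ π * N := mul_le_mul_of_nonneg_left (by linarith) hπ0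
    have h3 : π * (ε * T) ≤ 1 * (ε * T) := mul_le_mul_of_nonneg_right hπ1 (by positivity)
    rw [abs_le]
    constructor <;> nlinarith
  have : M / N - π = (M - π * N) / N := by field_simp
  rw [this, abs_div, abs_of_pos hN0, div_le_div_iff₀ hN0 hβ0]
  calc |M - π * N| * β ≤ ε * T * β := mul_le_mul_of_nonneg_right hdiff hβ0.le
    _ = 8 * ε * (β / 8 * T) := by ring
    _ ≤ 8 * ε * N := mul_le_mul_of_nonneg_left hN8 (by positivity)

omit [Finite K] in
theorem smoothProportion_nonneg (d t : ℕ) : 0 ≤ smoothProportion K d t := by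
  unfold smoothProportion; positivity

theorem smoothProportion_le_one (d t : ℕ) : smoothProportion K d t ≤ 1 := by
  refine div_le_one_of_le₀ ?_ (by positivity)
  have hsub : {F ∈ smoothForms K d | (rationalPoints F).ncard = t} ⊆ smoothForms K d :=
    fun F hF => hF.1
  exact_mod_cast Set.ncard_le_ncard hsub (smoothForms_finite K d)

theorem smoothProportion_eq_zero {d t : ℕ} (ht : Nat.card K ^ 2 + Nat.card K + 1 < t) :
    smoothProportion K d t = 0 := by
  have : {F ∈ smoothForms K d | (rationalPoints F).ncard = t} = ∅ := by
    ext F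
    simp only [Set.mem_ofPred_eq, Set.mem_empty_iff_false, iff_false, not_and]
    intro _ h
    have := Set.ncard_le_card (rationalPoints F)
    rw [card_rationalPlane] at this
    omega
  simp [smoothProportion, this]

end Proportion

/-! ### Asymptotics for fixed `q` -/

section Asymptotics

/-- Since `q ^ t ≥ 1` and the other summands are nonnegative, a bound by `d ^ (-1/3)` suffices for
the theorem. -/
theorem rpow_neg_third_le_errorTerm (q p d t : ℕ) (hq : 2 ≤ q) :
    (d : ℝ) ^ (-(1 / 3 : ℝ)) ≤ errorTerm q p d t := by
  have hq1 : (1 : ℝ) ≤ q := by exact_mod_cast (by omega : 1 ≤ q)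
  have h1 : (1 : ℝ) ≤ (q : ℝ) ^ t := one_le_pow₀ hq1
  unfold errorTerm
  have h2 : 0 ≤ ((d : ℝ) - 1) ^ 2 * (q : ℝ) ^ (-min ((⌊(d : ℝ) / p⌋ : ℝ) + 1) ((d : ℝ) / 3)) := by
    positivity
  have h3 : 0 ≤ (d : ℝ) * (q : ℝ) ^ (-(⌊((d : ℝ) - 1) / p⌋ : ℝ) - 1) := by positivity
  have h4 : 0 ≤ (d : ℝ) ^ (-(1 / 3 : ℝ)) := by positivity
  nlinarith

/-- A quartic in `d` against an exponential in `d / q`; the boundedness of `m ^ 5 / 2 ^ m` leaves a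
factor `1 / d` to spare. -/
theorem exists_highDegreeBound_le {q : ℕ} (hq : 2 ≤ q) :
    ∃ D : ℝ, 0 ≤ D ∧ ∀ d : ℕ, 1 ≤ d → highDegreeBound q d ≤ D / d := by
  obtain ⟨M, hM⟩ := (tendsto_pow_const_div_const_pow_of_one_lt 5
    (by norm_num : (1 : ℝ) < 2)).bddAbove_range
  have hM' : ∀ m : ℕ, (m : ℝ) ^ 5 / 2 ^ m ≤ M := fun m => hM ⟨m, rfl⟩
  have hM0 : 0 ≤ M := le_trans (by positivity) (hM' 0)
  have hqR : (2 : ℝ) ≤ q := by exact_mod_cast hq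
  refine ⟨36 * (q : ℝ) ^ 5 * M, by positivity, fun d hd => ?_⟩
  set m := (d - 1) / q + 1 with hm
  have hdm : d ≤ q * m := by
    have := Nat.lt_mul_div_succ (d - 1) (by omega : 0 < q)
    rw [hm]; omega
  have hdm' : (d : ℝ) ≤ q * m := by exact_mod_cast hdm
  have hd1 : (1 : ℝ) ≤ d := by exact_mod_cast hd
  have h2m : (2 : ℝ) ^ m ≤ (q : ℝ) ^ m := pow_le_pow_left₀ (by norm_num) hqR m
  -- Here `12 = 1 + 2 + 4 + 4 + 1` is the sum of the coefficients.
  have hpoly : ((1 + 2 * d + ((2 * d + 1) * d) ^ 2 : ℕ) : ℝ) * d ≤ 12 * (d : ℝ) ^ 5 := by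
    push_cast
    have e2 : (d : ℝ) ≤ (d : ℝ) ^ 5 := le_self_pow₀ hd1 (by norm_num)
    have e3 : (d : ℝ) ^ 2 ≤ (d : ℝ) ^ 5 := pow_le_pow_right₀ hd1 (by norm_num)
    have e4 : (d : ℝ) ^ 3 ≤ (d : ℝ) ^ 5 := pow_le_pow_right₀ hd1 (by norm_num)
    have e5 : (d : ℝ) ^ 4 ≤ (d : ℝ) ^ 5 := pow_le_pow_right₀ hd1 (by norm_num)
    nlinarith
  rw [highDegreeBound, ← hm, div_le_div_iff₀ (by positivity) (by linarith)]
  have h5 : (d : ℝ) ^ 5 ≤ (q : ℝ) ^ 5 * (m : ℝ) ^ 5 := by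
    rw [← mul_pow]; exact pow_le_pow_left₀ (by positivity) hdm' 5
  have h6 : (m : ℝ) ^ 5 ≤ M * (q : ℝ) ^ m := by
    have := hM' m
    rw [div_le_iff₀ (by positivity)] at this
    exact this.trans (mul_le_mul_of_nonneg_left h2m hM0)
  calc 3 * ((1 + 2 * d + ((2 * d + 1) * d) ^ 2 : ℕ) : ℝ) * d ≤ 3 * (12 * (d : ℝ) ^ 5) := by
        linarith
    _ ≤ 36 * ((q : ℝ) ^ 5 * (m : ℝ) ^ 5) := by linarith
    _ ≤ 36 * ((q : ℝ) ^ 5 * (M * (q : ℝ) ^ m)) := by gcongr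
    _ = _ := by ring

/-- For fixed `q` the proportion of curves with `t` points converges with error `O(1 / d)`. -/
theorem exists_abs_smoothProportion_sub_le {q : ℕ} (hq : 2 ≤ q) :
    ∃ (D : ℝ) (d₀ : ℕ), 0 ≤ D ∧ 1 ≤ d₀ ∧ ∀ (K : Type u) [Field K] [Finite K], Nat.card K = q →
      ∀ d t : ℕ, d₀ ≤ d → |smoothProportion K d t - pointCountProb q t| ≤ D / d := by
  obtain ⟨D₁, hD₁, hD⟩ := exists_highDegreeBound_le hq
  set β := rationalSmoothDensity q with hβ
  have hβ0 : 0 < β := rationalSmoothDensity_pos hq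
  set D₂ : ℝ := 32 * q + D₁ with hD₂
  have hD₂0 : 0 ≤ D₂ := by positivity
  obtain ⟨n, hn⟩ := exists_nat_ge (D₂ / min (1 / 6) (β / 8))
  refine ⟨8 * D₂ / β, 16 * q + n, by positivity, by omega, fun K _ _ hK d t hd => ?_⟩
  have hd1 : 1 ≤ d := by omega
  have hd1' : (0 : ℝ) < d := by exact_mod_cast hd1
  -- The largest `r` with `16 q ^ r ≤ d`: interpolation is possible, while `d < 16 q ^ (r + 1)`
  -- roughly and hence `2 / q ^ r ≤ 32 q / d`. The threshold `16 * q` on `d` ensures `r ≥ 1`.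
  set r := Nat.log q (d / 16) with hr
  have hd16 : q ≤ d / 16 := by omega
  have hr1 : 1 ≤ r := (Nat.le_log_iff_pow_le (by omega) (by omega)).mpr (by simpa using hd16)
  have hrle : q ^ r ≤ d / 16 := Nat.pow_log_le_self q (by omega)
  have hrlt : d / 16 < q ^ (r + 1) := Nat.lt_pow_succ_log_self (by omega) _
  have hd8 : 8 * Nat.card K ^ r + 3 ≤ d := by rw [hK]; omega
  have hqr : 2 / (q : ℝ) ^ r ≤ 32 * q / d := by
    rw [div_le_div_iff₀ (by positivity) hd1']
    have : d ≤ 16 * q ^ (r + 1) := by omega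
    have h : (d : ℝ) ≤ 16 * (q : ℝ) ^ (r + 1) := by exact_mod_cast this
    rw [pow_succ] at h
    linarith
  have hε : 2 / (Nat.card K : ℝ) ^ r + highDegreeBound (Nat.card K) d ≤ D₂ / d := by
    rw [hK, hD₂, add_div]
    exact add_le_add hqr (hD d hd1)
  have hmin : 0 < min (1 / 6) (β / 8) := by positivity
  have hsmall : D₂ / d ≤ min (1 / 6) (β / 8) := by
    rw [div_le_iff₀ hd1', mul_comm, ← div_le_iff₀ hmin]
    exact hn.trans (by exact_mod_cast (by omega : n ≤ d))
  have := abs_smoothProportion_sub_le K hr1 hd8 hε (hsmall.trans (min_le_left _ _))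
    (by rw [hK]; exact hsmall.trans (min_le_right _ _)) t
  rw [hK] at this
  refine this.trans (le_of_eq ?_)
  rw [← hβ]; field_simp

theorem exists_relative_error_bounds {q : ℕ} (hq : 2 ≤ q) :
    ∃ (d₀ : ℕ) (Cq : ℝ), ∀ (K : Type u) [Field K] [Finite K], Nat.card K = q →
      ∀ d t : ℕ, 1 ≤ d → ∃ δ : ℝ,
        smoothProportion K d t = pointCountProb q t * (1 + δ) ∧
        |δ| ≤ Cq * (d : ℝ) ^ (-(1 / 3 : ℝ)) ∧
        (d₀ ≤ d → |δ| ≤ (d : ℝ) ^ (-(1 / 3 : ℝ))) := by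
  obtain ⟨D, d₁, hD0, hd₁, hD⟩ := exists_abs_smoothProportion_sub_le.{u} hq
  have hqR : (2 : ℝ) ≤ q := by exact_mod_cast hq
  obtain ⟨π₀, hπ₀, hπ⟩ : ∃ π₀ : ℝ, 0 < π₀ ∧
      ∀ t : ℕ, t ≤ q ^ 2 + q + 1 → π₀ ≤ pointCountProb q t :=
    ⟨_, by positivity, fun t ht => pointCountProb_ge ht⟩
  obtain ⟨d₂, hd₂⟩ : ∃ d₂ : ℕ, ∀ d : ℕ, d₂ ≤ d → D / π₀ ≤ (d : ℝ) ^ (2 / 3 : ℝ) := by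
    have := ((tendsto_rpow_atTop (by norm_num : (0 : ℝ) < 2 / 3)).comp
      tendsto_natCast_atTop_atTop).eventually_ge_atTop (D / π₀)
    exact Filter.eventually_atTop.mp this
  set d₀ := max d₁ d₂ with hd₀
  -- For `d < d₀` the trivial bound `1 / π₀ + 1` on the relative error suffices, because `d₀ * d ^
  -- (-1/3) ≥ d * d⁻¹ = 1`.
  refine ⟨d₀, 1 + (1 / π₀ + 1) * d₀, fun K _ _ hK d t hd => ?_⟩
  have hd1 : (1 : ℝ) ≤ d := by exact_mod_cast hd
  have hpos : 0 < (d : ℝ) ^ (-(1 / 3 : ℝ)) := by positivity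
  -- With more points than the plane contains, proportion and probability both vanish, and `δ = 0`
  -- works.
  rcases lt_or_ge (q ^ 2 + q + 1) t with ht | ht
  · refine ⟨0, ?_, by rw [abs_zero]; positivity, fun _ => by rw [abs_zero]; positivity⟩
    rw [smoothProportion_eq_zero K (by rw [hK]; exact ht), pointCountProb,
      Nat.choose_eq_zero_of_lt ht]
    simp
  · set π := pointCountProb q t with hπdef
    have hπt : π₀ ≤ π := hπ t ht
    have hπ0 : 0 < π := hπ₀.trans_le hπt
    have hlarge : d₀ ≤ d → |smoothProportion K d t / π - 1| ≤ (d : ℝ) ^ (-(1 / 3 : ℝ)) := by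
      intro h
      have h1 := hD K hK d t ((le_max_left _ _).trans h)
      have h2 := hd₂ d ((le_max_right _ _).trans h)
      have e : smoothProportion K d t / π - 1 = (smoothProportion K d t - π) / π := by
        field_simp
      rw [e, abs_div, abs_of_pos hπ0]
      calc |smoothProportion K d t - π| / π ≤ (D / d) / π₀ :=
            div_le_div₀ (by positivity) h1 hπ₀ hπt
        _ = (D / π₀) / d := by field_simp
        _ ≤ (d : ℝ) ^ (2 / 3 : ℝ) / d := by gcongr
        _ = (d : ℝ) ^ (-(1 / 3 : ℝ)) := by
          rw [← Real.rpow_sub_one (by positivity)]; norm_num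
    refine ⟨smoothProportion K d t / π - 1, by field_simp; ring, ?_, hlarge⟩
    have hcoef : 0 ≤ (1 / π₀ + 1) * (d₀ : ℝ) := by positivity
    rcases le_or_gt d₀ d with h | h
    · refine (hlarge h).trans (le_mul_of_one_le_left hpos.le (by linarith))
    · have h1 : |smoothProportion K d t / π - 1| ≤ 1 / π₀ + 1 := by
        have h0 := smoothProportion_nonneg K d t
        have h2 : smoothProportion K d t / π ≤ 1 / π₀ :=
          div_le_div₀ zero_le_one (smoothProportion_le_one K d t) hπ₀ hπt
        have h3 : 0 ≤ smoothProportion K d t / π := by positivity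
        have h4 : 0 < 1 / π₀ := by positivity
        rw [abs_le]; constructor <;> linarith
      have h2 : 1 ≤ (d₀ : ℝ) * (d : ℝ) ^ (-(1 / 3 : ℝ)) := by
        have e1 : (d : ℝ) ^ (-1 : ℝ) ≤ (d : ℝ) ^ (-(1 / 3 : ℝ)) :=
          Real.rpow_le_rpow_of_exponent_le hd1 (by norm_num)
        have e2 : (d : ℝ) * (d : ℝ) ^ (-1 : ℝ) = 1 := by
          rw [Real.rpow_neg_one]; field_simp
        have e3 : (d : ℝ) ≤ d₀ := by exact_mod_cast h.le
        exact e2.symm.le.trans (mul_le_mul e3 e1 (by positivity) (by positivity))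
      have h3 : 0 ≤ 1 / π₀ + 1 := by positivity
      calc |smoothProportion K d t / π - 1| ≤ (1 / π₀ + 1) * 1 := by rw [mul_one]; exact h1
        _ ≤ (1 / π₀ + 1) * ((d₀ : ℝ) * (d : ℝ) ^ (-(1 / 3 : ℝ))) := by gcongr
        _ ≤ (1 + (1 / π₀ + 1) * d₀) * (d : ℝ) ^ (-(1 / 3 : ℝ)) := by
          have e (a b c : ℝ) : (1 + a * b) * c = c + a * (b * c) := by ring
          rw [e]; linarith

end Asymptotics

/-! ### The theorem -/

theorem theorem1 :
    ∃ C : ℝ, ∀ q : ℕ, ∃ (d₀ : ℕ) (Cq : ℝ),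
      ∀ (K : Type u) [Field K] [Finite K] (p : ℕ) [CharP K p], Nat.card K = q →
      ∀ (Ω : Type v) [MeasurableSpace Ω] (μ : Measure Ω) [IsProbabilityMeasure μ]
        (X : Fin (q ^ 2 + q + 1) → Ω → ℝ),
        (∀ i, Measurable (X i)) → iIndepFun X μ →
        (∀ i, μ.real {ω | X i ω = 1} = ((q : ℝ) + 1) / ((q : ℝ) ^ 2 + q + 1)) →
        (∀ i, μ.real {ω | X i ω = 0} = (q : ℝ) ^ 2 / ((q : ℝ) ^ 2 + q + 1)) →
      ∀ d t : ℕ, 1 ≤ d →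
        (smoothForms K d).Nonempty ∧
        ∃ δ : ℝ,
          smoothProportion K d t = μ.real {ω | ∑ i, X i ω = (t : ℝ)} * (1 + δ) ∧
          |δ| ≤ Cq * errorTerm q p d t ∧
          (d₀ ≤ d → |δ| ≤ C * errorTerm q p d t) := by
  -- The absolute constant can be `1`: the true error is `O_q(1 / d)`, and `d₀` absorbs its
  -- dependence on `q`.
  refine ⟨1, fun q => ?_⟩
  by_cases hq : 2 ≤ q
  · obtain ⟨d₀, Cq, h⟩ := exists_relative_error_bounds.{u} hq
    refine ⟨d₀, |Cq|, ?_⟩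
    intro K _ _ p _ hK Ω _ μ _ X hX hind h1 h0 d t hd
    refine ⟨smoothForms_nonempty K hd, ?_⟩
    obtain ⟨δ, e1, e2, e3⟩ := h K hK d t hd
    have hE := rpow_neg_third_le_errorTerm q p d t hq
    have hpos : (0 : ℝ) ≤ (d : ℝ) ^ (-(1 / 3 : ℝ)) := by positivity
    refine ⟨δ, ?_, ?_, fun hd₀ => by rw [one_mul]; exact (e3 hd₀).trans hE⟩
    · rw [real_sum_eq_binomial μ hX hind h1 h0 (by field_simp; ring) t]
      exact e1
    · exact e2.trans (mul_le_mul (le_abs_self Cq) hE hpos (abs_nonneg _))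
  -- No field has fewer than two elements.
  · refine ⟨0, 0, ?_⟩
    intro K _ _ p _ hK
    exact absurd (hK ▸ Finite.one_lt_card (α := K)) hq
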